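/- Let $\mathsf H$ be a quaternionic right Hilbert space with scalar product $\langle u|v\rangle$ (right $\mathbb H$-linear in $v$), and let $\mathfrak B(\mathsf H)$ be the set of its continuous right $\mathbb H$-linear operators. Let $\mathbb S=\{q\in\mathbb H: q^2=-1\}$ and, for $\imath\in\mathbb S$, let $\mathbb C^+_\imath=\{\alpha+\imath\beta:\alpha,\beta\in\mathbb R,\ \beta\ge 0\}$ with its Borel $\sigma$-algebra $\mathscr B(\mathbb C_\imath^+)$. An iqPVM over $\mathbb C^+_\imath$ in $\mathsf H$ is a pair $\mathcal P=(P,\mathcal L)$ such that: * $P:\mathscr B(\mathbb C^+_\imath)\to\mathfrak B(\mathsf H)$ satisfies $P(\mathbb C^+_\imath)=\mathrm I$, $P(E)P(E')=P(E\cap E')$, $P(\bigcup_n E_n)u=\sum_n P(E_n)u$ for every $u\in\mathsf H$ and all countable families of pairwise disjoint Borel sets $E_n$, and $\langle u|P(E)u\rangle\in[0,\infty)$ for every $u\in\mathsf H$; * $\mathcal L:q\mapsto L_q$ is the left scalar multiplication induced by some Hilbert basis $N$ of $\mathsf H$, i.e. $L_qu=\sum_{z\in N}zq\langle z|u\rangle$;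 * $P(E)L_q=L_qP(E)$ for all $E\in\mathscr B(\mathbb C^+_\imath)$ and $q\in\mathbb H$. Put $\mu_u(E)=\langle u|P(E)u\rangle$, a finite Borel measure. For a simple function $s=\sum_\ell S_\ell\chi_{E_\ell}$ (the $E_\ell$ disjoint Borel sets, $S_\ell\in\mathbb H$) put $\int s\,d\mathcal P=\sum_\ell L_{S_\ell}P(E_\ell)$. For bounded measurable $\varphi:\mathbb C_\imath^+\to\mathbb H$ let $\int\varphi\,d\mathcal P\in\mathfrak B(\mathsf H)$ be the operator-norm limit of $\int s_n\,d\mathcal P$ for any sequence of simple functions $s_n\to\varphi$ uniformly. For measurable $f:\mathbb C_\imath^+\to\mathbb H$ let $D_f=\{u\in\mathsf H: f\in L^2(\mu_u)\}$, let $f_n=f$ where $|f|\le n$ and $f_n=0$ elsewhere, and put $\int f\,d\mathcal P\,u=\lim_{n}\int f_n\,d\mathcal P\,u$ for $u\in D_f$. Call $f$ $P$-essentially bounded if $P(\{|f|>k\})=0$ for some $k\in[0,\infty)$. Operators $T$, $S$ with domains $D(T)$, $D(S)$ are added on $D(T+S)=D(T)\cap D(S)$ and composed on $D(TS)=\{u\in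 D(S): Su\in D(T)\}$; $T\subset S$ means that $S$ extends $T$; and $T^*$ is the adjoint of a densely defined $T$. **Theorem.** Let $\mathcal P=(P,\mathcal L)$ be an iqPVM over $\mathbb C^+_\imath$ in $\mathsf H$ and let $f,g:\mathbb C^+_\imath\to\mathbb H$ be measurable. Then $D_f$ is a dense right $\mathbb H$-linear subspace of $\mathsf H$, $\int f\,d\mathcal P$ is a well-defined right $\mathbb H$-linear operator with domain $D_f$, and if $f$ is bounded it coincides with the (well-defined) bounded integral. Moreover: (a) $D\big(\int f\,d\mathcal P\int g\,d\mathcal P\big)=D_g\cap D_{fg}$ and $\int f\,d\mathcal P\int g\,d\mathcal P\subset\int fg\,d\mathcal P$, with equality if and only if $D_{fg}\subset D_g$. (b) $D\big(\int f\,d\mathcal P+\int g\,d\mathcal P\big)=D_f\cap D_g$ and $\int f\,d\mathcal P+\int g\,d\mathcal P\subset\int (f+g)\,d\mathcal P$, with equality if and only if $D_{f+g}\subset D_f\cap D_g$. (c) $D_f=D_{\bar f}$ and $\big(\int f\,d\mathcal P\big)^*=\int\bar f\,d\mathcal P$. In particular $\int f\,d\mathcal P$ is a closed operator. (d) $\int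 f\,d\mathcal P$ is normal, and $\big(\int f\,d\mathcal P\big)^*\big(\int f\,d\mathcal P\big)=\int|f|^2\,d\mathcal P=\big(\int f\,d\mathcal P\big)\big(\int f\,d\mathcal P\big)^*$. (e) $D_f=\mathsf H$ if and only if $f$ is $P$-essentially bounded. In particular, equality holds in the inclusion of (a) if $g$ is $P$-essentially bounded, and in that of (b) if at least one of $f$ and $g$ is $P$-essentially bounded. (f) Let $\jmath\in\mathbb S$, let $\Psi:\mathbb C^+_\imath\to\mathbb C^+_\jmath$ be measurable and let $Q(E)=P(\Psi^{-1}(E))$ for $E\in\mathscr B(\mathbb C^+_\jmath)$. Then $\mathcal Q=(Q,\mathcal L)$ is an iqPVM over $\mathbb C^+_\jmath$ in $\mathsf H$, and $\int_{\mathbb C^+_\imath}\xi\circ\Psi\,d\mathcal P=\int_{\mathbb C^+_\jmath}\xi\,d\mathcal Q$ for every measurable $\xi:\mathbb C^+_\jmath\to\mathbb H$. -/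

import Mathlib

open MeasureTheory Filter Topology
open scoped Quaternion ENNReal NNReal

/-- The quaternions carry their Borel `σ`-algebra. -/
noncomputable instance Quaternion.instMeasurableSpaceBorel : MeasurableSpace ℍ[ℝ] := borel ℍ[ℝ]

instance Quaternion.instBorelSpaceReal : BorelSpace ℍ[ℝ] := ⟨rfl⟩

namespace QuaternionicIntegral

noncomputable section

/-! ### Quaternionic Hilbert spaces -/

/-- The Hermitian scalar product of a quaternionic right Hilbert space. The right scalar
multiplication `u q` is the action `MulOpposite.op q • u` of the opposite ring; the norm of `H` is
the one given by the scalar product. Completeness is required separately by `CompleteSpace H`. -/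
class QInnerProductSpace (H : Type*) [NormedAddCommGroup H] [Module ℍ[ℝ]ᵐᵒᵖ H] where
  qinner : H → H → ℍ[ℝ]
  qinner_add_right : ∀ u v w : H, qinner u (v + w) = qinner u v + qinner u w
  qinner_smul_right : ∀ (u v : H) (q : ℍ[ℝ]),
    qinner u (MulOpposite.op q • v) = qinner u v * q
  qinner_conj : ∀ u v : H, qinner u v = star (qinner v u)
  qinner_self : ∀ u : H, qinner u u = ((‖u‖ ^ 2 : ℝ) : ℍ[ℝ])

section Hilbert

variable {H : Type*} [NormedAddCommGroup H] [Module ℍ[ℝ]ᵐᵒᵖ H] [QInnerProductSpace H]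

/-- The scalar product `⟨u | v⟩`. -/
def qinner (u v : H) : ℍ[ℝ] := QInnerProductSpace.qinner u v

theorem qinner_add_right (u v w : H) : qinner u (v + w) = qinner u v + qinner u w :=
  QInnerProductSpace.qinner_add_right u v w

theorem qinner_smul_right (u v : H) (q : ℍ[ℝ]) :
    qinner u (MulOpposite.op q • v) = qinner u v * q :=
  QInnerProductSpace.qinner_smul_right u v q

theorem qinner_conj (u v : H) : qinner u v = star (qinner v u) :=
  QInnerProductSpace.qinner_conj u v

theorem qinner_self (u : H) : qinner u u = ((‖u‖ ^ 2 : ℝ) : ℍ[ℝ]) :=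
  QInnerProductSpace.qinner_self u

theorem qinner_add_left (u v w : H) : qinner (u + v) w = qinner u w + qinner v w := by
  rw [qinner_conj, qinner_add_right, star_add, ← qinner_conj, ← qinner_conj]

theorem qinner_smul_left (u v : H) (q : ℍ[ℝ]) :
    qinner (MulOpposite.op q • u) v = star q * qinner u v := by
  rw [qinner_conj, qinner_smul_right, star_mul, ← qinner_conj]

theorem qinner_neg_right (u v : H) : qinner u (-v) = -qinner u v := by
  have h : (-v : H) = MulOpposite.op (-1 : ℍ[ℝ]) • v := by simp
  rw [h, qinner_smul_right]; simp

theorem qinner_neg_left (u v : H) : qinner (-u) v = -qinner u v := by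
  rw [qinner_conj, qinner_neg_right, star_neg, ← qinner_conj]

theorem qinner_sub_right (u v w : H) : qinner u (v - w) = qinner u v - qinner u w := by
  rw [sub_eq_add_neg, qinner_add_right, qinner_neg_right, sub_eq_add_neg]

theorem qinner_sub_left (u v w : H) : qinner (u - v) w = qinner u w - qinner v w := by
  rw [sub_eq_add_neg, qinner_add_left, qinner_neg_left, sub_eq_add_neg]

theorem qinner_zero_right (u : H) : qinner u (0 : H) = 0 := by
  have h := qinner_sub_right u 0 0
  simpa using h

theorem qinner_zero_left (u : H) : qinner (0 : H) u = 0 := by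
  rw [qinner_conj, qinner_zero_right, star_zero]

theorem re_qinner_eq (u v : H) : (qinner u v).re = (‖u + v‖ ^ 2 - ‖u - v‖ ^ 2) / 4 := by
  have h1 : (qinner (u + v) (u + v)).re = ‖u + v‖ ^ 2 := by rw [qinner_self, Quaternion.re_coe]
  have h2 : (qinner (u - v) (u - v)).re = ‖u - v‖ ^ 2 := by rw [qinner_self, Quaternion.re_coe]
  have h3 : (qinner v u).re = (qinner u v).re := by rw [qinner_conj v u]; simp
  rw [← h1, ← h2]
  simp only [qinner_add_left, qinner_add_right, qinner_sub_left, qinner_sub_right,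
    Quaternion.re_add, Quaternion.re_sub, h3]
  ring

theorem continuous_re_qinner (u : H) : Continuous fun v : H => (qinner u v).re := by
  simp only [re_qinner_eq]
  fun_prop

theorem norm_qsmul (c : ℍ[ℝ]ᵐᵒᵖ) (u : H) : ‖c • u‖ = ‖c.unop‖ * ‖u‖ := by
  have h : ((‖c • u‖ ^ 2 : ℝ) : ℍ[ℝ]) = (((‖c.unop‖ * ‖u‖) ^ 2 : ℝ) : ℍ[ℝ]) := by
    rw [← qinner_self, ← MulOpposite.op_unop c, qinner_smul_left, qinner_smul_right, qinner_self,
      Quaternion.coe_commutes, ← mul_assoc, Quaternion.star_mul_self,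
      Quaternion.normSq_eq_norm_mul_self, ← Quaternion.coe_mul]
    congr 1
    simp only [MulOpposite.unop_op]
    ring
  exact (sq_eq_sq₀ (norm_nonneg _) (by positivity)).mp (Quaternion.coe_injective h)

theorem continuous_qsmul (c : ℍ[ℝ]ᵐᵒᵖ) : Continuous fun u : H => c • u := by
  let φ : H →+ H := DistribSMul.toAddMonoidHom H c
  exact AddMonoidHomClass.continuous_of_bound φ ‖c.unop‖ fun u => (norm_qsmul c u).le

/-- A Hilbert basis: an orthonormal set with trivial orthogonal complement. -/
structure IsHilbertBasis (N : Set H) : Prop where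
  norm_eq_one : ∀ z ∈ N, ‖z‖ = 1
  orthogonal : ∀ z ∈ N, ∀ z' ∈ N, z ≠ z' → qinner z z' = 0
  eq_zero_of_orthogonal : ∀ u : H, (∀ z ∈ N, qinner u z = 0) → u = 0

/-- `L` is the left scalar multiplication `q ↦ L_q` induced by some Hilbert basis `N`, that is
`L_q u = ∑_{z ∈ N} z q ⟨z | u⟩`. -/
def IsLeftScalarMul (L : ℍ[ℝ] → (H →L[ℍ[ℝ]ᵐᵒᵖ] H)) : Prop :=
  ∃ N : Set H, IsHilbertBasis N ∧ ∀ (q : ℍ[ℝ]) (u : H),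
    HasSum (fun z : N => MulOpposite.op (q * qinner (z : H) u) • (z : H)) (L q u)

/-! ### Operators with a domain -/

/-- The composition `T S`, with domain `{u ∈ D(S) | S u ∈ D(T)}`. -/
def opComp (T S : H →ₗ.[ℍ[ℝ]ᵐᵒᵖ] H) : H →ₗ.[ℍ[ℝ]ᵐᵒᵖ] H :=
  T.comp (S.domRestrict ((T.domain.comap S.toFun).map S.domain.subtype)) (by
    rintro ⟨x, hx⟩
    obtain ⟨y, hy, hyx⟩ := hx.1
    subst hyx
    exact hy)

/-- The graph of the adjoint: the pairs `(u, w)` with `⟨w | v⟩ = ⟨u | T v⟩` for all `v ∈ D(T)`. -/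
def adjointGraph (T : H →ₗ.[ℍ[ℝ]ᵐᵒᵖ] H) : Submodule ℍ[ℝ]ᵐᵒᵖ (H × H) where
  carrier := {p | ∀ v : T.domain, qinner p.2 (v : H) = qinner p.1 (T v)}
  add_mem' := by
    intro a b ha hb v
    simp only [Prod.fst_add, Prod.snd_add, qinner_add_left, ha v, hb v]
  zero_mem' := by
    intro v
    simp only [Prod.fst_zero, Prod.snd_zero, qinner_zero_left]
  smul_mem' := by
    intro c a ha v
    induction c using MulOpposite.rec' with
    | h q => simp only [Prod.smul_fst, Prod.smul_snd, qinner_smul_left, ha v]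

/-- The adjoint `T*` of a densely defined operator `T`. -/
def opAdjoint (T : H →ₗ.[ℍ[ℝ]ᵐᵒᵖ] H) : H →ₗ.[ℍ[ℝ]ᵐᵒᵖ] H := (adjointGraph T).toLinearPMap

/-- An operator is closed if its graph is closed in `H × H`. -/
def OpIsClosed (T : H →ₗ.[ℍ[ℝ]ᵐᵒᵖ] H) : Prop := IsClosed (T.graph : Set (H × H))

/-- A (densely defined) operator is normal if `T T* = T* T`. -/
def OpIsNormal (T : H →ₗ.[ℍ[ℝ]ᵐᵒᵖ] H) : Prop := opComp T (opAdjoint T) = opComp (opAdjoint T) T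

end Hilbert

/-! ### Intertwining quaternionic projection-valued measures -/

/-- The sphere of imaginary units of the quaternions. -/
def imaginaryUnits : Set ℍ[ℝ] := {q | q * q = -1}

/-- The closed half plane `{α + ι β | α, β ∈ ℝ, β ≥ 0}`; as a type it carries the topology and the
Borel `σ`-algebra induced by the quaternions. -/
def halfPlane (ι : ℍ[ℝ]) : Set ℍ[ℝ] := {q | ∃ α β : ℝ, 0 ≤ β ∧ q = (α : ℍ[ℝ]) + ι * (β : ℍ[ℝ])}

/-- An intertwining quaternionic projection-valued measure `(P, L)` over the half plane of `ι`
in `H`. Only the values of `P` on Borel sets matter. -/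
structure IqPVM (ι : ℍ[ℝ]) (H : Type*) [NormedAddCommGroup H] [Module ℍ[ℝ]ᵐᵒᵖ H]
    [QInnerProductSpace H] where
  P : Set (halfPlane ι) → (H →L[ℍ[ℝ]ᵐᵒᵖ] H)
  L : ℍ[ℝ] → (H →L[ℍ[ℝ]ᵐᵒᵖ] H)
  P_univ : P Set.univ = ContinuousLinearMap.id ℍ[ℝ]ᵐᵒᵖ H
  P_inter : ∀ E F, MeasurableSet E → MeasurableSet F → (P E).comp (P F) = P (E ∩ F)
  P_iUnion : ∀ E : ℕ → Set (halfPlane ι), (∀ n, MeasurableSet (E n)) →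
    Pairwise (Function.onFun Disjoint E) → ∀ u : H, HasSum (fun n => P (E n) u) (P (⋃ n, E n) u)
  P_nonneg : ∀ E, MeasurableSet E → ∀ u : H,
    ∃ r : ℝ, 0 ≤ r ∧ qinner u (P E u) = ((r : ℝ) : ℍ[ℝ])
  isLeftScalarMul : IsLeftScalarMul L
  P_comm : ∀ E, MeasurableSet E → ∀ q, (P E).comp (L q) = (L q).comp (P E)

namespace IqPVM

variable {ι : ℍ[ℝ]} {H : Type*} [NormedAddCommGroup H] [Module ℍ[ℝ]ᵐᵒᵖ H] [QInnerProductSpace H]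
  (PL : IqPVM ι H)

theorem re_nonneg {E : Set (halfPlane ι)} (hE : MeasurableSet E) (u : H) :
    0 ≤ (qinner u (PL.P E u)).re := by
  obtain ⟨r, hr, h⟩ := PL.P_nonneg E hE u
  rw [h]; simpa using hr

theorem P_empty_apply (u : H) : PL.P ∅ u = 0 := by
  have h := PL.P_iUnion (fun _ => ∅) (fun _ => MeasurableSet.empty)
    (fun i j _ => by simp [Function.onFun]) u
  exact tendsto_nhds_unique tendsto_const_nhds h.summable.tendsto_atTop_zero

/-- The finite Borel measure `μ_u(E) = ⟨u | P(E) u⟩`. -/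
def measure (u : H) : Measure (halfPlane ι) :=
  Measure.ofMeasurable (fun E _ => ENNReal.ofReal (qinner u (PL.P E u)).re)
    (by simp [P_empty_apply, qinner_zero_right])
    (by
      intro E hE hd
      have h := PL.P_iUnion E hE hd u
      let φ : H →+ ℝ := AddMonoidHom.mk' (fun v : H => (qinner u v).re)
        (fun v w => by simp [qinner_add_right])
      have h' : HasSum (fun n => (qinner u (PL.P (E n) u)).re)
          (qinner u (PL.P (⋃ n, E n) u)).re := h.map φ (continuous_re_qinner u)
      rw [← h'.tsum_eq]
      exact ENNReal.ofReal_tsum_of_nonneg (fun n => PL.re_nonneg (hE n) u) h'.summable)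

theorem measure_apply (u : H) {E : Set (halfPlane ι)} (hE : MeasurableSet E) :
    PL.measure u E = ENNReal.ofReal (qinner u (PL.P E u)).re :=
  Measure.ofMeasurable_apply E hE

theorem measure_add_le (u v : H) :
    PL.measure (u + v) ≤ (2 : ℝ≥0∞) • (PL.measure u + PL.measure v) := by
  refine Measure.le_iff.mpr fun E hE => ?_
  simp only [Measure.smul_apply, Measure.add_apply, PL.measure_apply _ hE, smul_eq_mul]
  rw [← ENNReal.ofReal_add (PL.re_nonneg hE u) (PL.re_nonneg hE v),
    ← ENNReal.ofReal_ofNat, ← ENNReal.ofReal_mul (by norm_num)]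
  refine ENNReal.ofReal_le_ofReal ?_
  have h := PL.re_nonneg hE (u - v)
  simp only [map_sub, map_add, qinner_add_left, qinner_add_right, qinner_sub_left,
    qinner_sub_right, Quaternion.re_add, Quaternion.re_sub] at h ⊢
  linarith

theorem measure_smul (u : H) (q : ℍ[ℝ]) :
    PL.measure (MulOpposite.op q • u) = ENNReal.ofReal (‖q‖ ^ 2) • PL.measure u := by
  refine Measure.ext fun E hE => ?_
  simp only [Measure.smul_apply, PL.measure_apply _ hE, smul_eq_mul]
  rw [← ENNReal.ofReal_mul (by positivity)]
  congr 1
  obtain ⟨r, -, h⟩ := PL.P_nonneg E hE u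
  rw [map_smul, qinner_smul_left, qinner_smul_right, h, Quaternion.coe_commutes,
    ← mul_assoc, Quaternion.star_mul_self, Quaternion.normSq_eq_norm_mul_self]
  simp [pow_two]

/-- The domain `D_f = {u | f ∈ L²(μ_u)}`, a right subspace of `H`. -/
def squareDomain (f : halfPlane ι → ℍ[ℝ]) : Submodule ℍ[ℝ]ᵐᵒᵖ H where
  carrier := {u | MemLp f 2 (PL.measure u)}
  add_mem' := by
    intro u v hu hv
    refine MemLp.of_measure_le_smul (c := 2) (by simp) (PL.measure_add_le u v) ?_
    refine ⟨aestronglyMeasurable_add_measure_iff.mpr ⟨hu.1, hv.1⟩, ?_⟩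
    have h2 : (2 : ℝ≥0∞) ≠ 0 := by norm_num
    have h2' : (2 : ℝ≥0∞) ≠ ∞ := by norm_num
    rw [eLpNorm_lt_top_iff_lintegral_rpow_enorm_lt_top h2 h2', lintegral_add_measure]
    exact ENNReal.add_lt_top.mpr
      ⟨(eLpNorm_lt_top_iff_lintegral_rpow_enorm_lt_top h2 h2').mp hu.2,
        (eLpNorm_lt_top_iff_lintegral_rpow_enorm_lt_top h2 h2').mp hv.2⟩
  zero_mem' := by
    have h : PL.measure (0 : H) = 0 := Measure.ext fun E hE => by
      simp [PL.measure_apply _ hE, qinner_zero_left]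
    simp [h]
  smul_mem' := by
    intro c u hu
    induction c using MulOpposite.rec' with
    | h q =>
      change MemLp f 2 (PL.measure (MulOpposite.op q • u))
      rw [PL.measure_smul]
      exact MemLp.smul_measure hu ENNReal.ofReal_ne_top

/-- The norm `‖f‖_∞^(P) ∈ [0, ∞]`. -/
def essNorm (f : halfPlane ι → ℍ[ℝ]) : ℝ≥0∞ :=
  ⨅ (k : ℝ≥0) (_ : PL.P {q | (k : ℝ) < ‖f q‖} = 0), (k : ℝ≥0∞)

/-- `f` is `P`-essentially bounded. -/
def IsEssBounded (f : halfPlane ι → ℍ[ℝ]) : Prop := PL.essNorm f < ∞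

/-! ### The integral -/

/-- The integral `∑_ℓ L_{S_ℓ} P(E_ℓ)` of the simple function `s = ∑_ℓ S_ℓ χ_{E_ℓ}`. -/
def integralSimple (s : SimpleFunc (halfPlane ι) ℍ[ℝ]) : H →L[ℍ[ℝ]ᵐᵒᵖ] H :=
  ∑ x ∈ s.range, (PL.L x).comp (PL.P (s ⁻¹' {x}))

/-- `T` is the limit in operator norm of the integrals of `s n`, for every sequence `s` of simple
functions that converges uniformly to `φ`, and there is such a sequence. -/
def IsBoundedIntegral (φ : halfPlane ι → ℍ[ℝ]) (T : H →L[ℍ[ℝ]ᵐᵒᵖ] H) : Prop :=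
  (∃ s : ℕ → SimpleFunc (halfPlane ι) ℍ[ℝ], TendstoUniformly (fun n => ⇑(s n)) φ atTop) ∧
  ∀ s : ℕ → SimpleFunc (halfPlane ι) ℍ[ℝ], TendstoUniformly (fun n => ⇑(s n)) φ atTop →
    ∀ ε : ℝ, 0 < ε → ∀ᶠ n in atTop, ∀ u : H, ‖PL.integralSimple (s n) u - T u‖ ≤ ε * ‖u‖

open scoped Classical in
/-- The integral of a bounded measurable function `φ`. -/
def integralBounded (φ : halfPlane ι → ℍ[ℝ]) : H →L[ℍ[ℝ]ᵐᵒᵖ] H :=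
  if h : ∃ T, PL.IsBoundedIntegral φ T then h.choose else 0

open scoped Classical in
/-- The truncation `f_n`, equal to `f` where `|f| ≤ n` and to `0` elsewhere. -/
def truncation (f : halfPlane ι → ℍ[ℝ]) (n : ℕ) : halfPlane ι → ℍ[ℝ] :=
  fun q => if ‖f q‖ ≤ (n : ℝ) then f q else 0

/-- The graph of the integral of `f`: the pairs `(u, w)` with `u ∈ D_f` and
`w = lim_n (∫ f_n dPL) u`. -/
def integralGraph (f : halfPlane ι → ℍ[ℝ]) : Submodule ℍ[ℝ]ᵐᵒᵖ (H × H) where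
  carrier := {p | p.1 ∈ PL.squareDomain f ∧
    Tendsto (fun n : ℕ => PL.integralBounded (truncation f n) p.1) atTop (𝓝 p.2)}
  add_mem' := by
    intro a b ha hb
    refine ⟨add_mem ha.1 hb.1, ?_⟩
    simpa only [Prod.fst_add, Prod.snd_add, map_add] using ha.2.add hb.2
  zero_mem' := by
    refine ⟨zero_mem _, ?_⟩
    simp only [Prod.fst_zero, Prod.snd_zero, map_zero]
    exact tendsto_const_nhds
  smul_mem' := by
    intro c a ha
    refine ⟨Submodule.smul_mem _ c ha.1, ?_⟩
    simp only [Prod.smul_fst, Prod.smul_snd, map_smul]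
    exact ((continuous_qsmul c).tendsto a.2).comp ha.2

/-- The operator `∫ f dPL`, which sends `u ∈ D_f` to `lim_n (∫ f_n dPL) u`. -/
def integral (f : halfPlane ι → ℍ[ℝ]) : H →ₗ.[ℍ[ℝ]ᵐᵒᵖ] H := (PL.integralGraph f).toLinearPMap

end IqPVM

end

end QuaternionicIntegral

open QuaternionicIntegral

/-!
For `u ∈ H` the simple integral satisfies `‖(∫ s dPL) u‖ = ‖s‖` in `L²(μ_u)`, because
`s ↦ ∫ s dPL` is a `*`-homomorphism, so `s ↦ (∫ s dPL) u` extends to an isometry on `L²(μ_u)`. Its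
value at `f` is the limit of the integrals of the truncations of `f`, and also the value of the
bounded integral when `f` is bounded.

Products: if `v = (∫ g dPL) u`, then `μ_v = |g|² μ_u`. Hence `v ∈ D_f` if and only if
`u ∈ D_{fg}`, and multiplication by `g` carries simple approximations of `f` in `L²(μ_v)` to
approximations of `f g` in `L²(μ_u)`.

Adjoint: let `E_n = {|f| ≤ n}`, so that `P(E_n) → I` strongly and `P(E_n)` maps `H` into `D_f`;
this gives density. If `⟨w | v⟩ = ⟨u | (∫ f dPL) v⟩` for all `v ∈ D_f`, testing with `P(E_n) v`
shows that `P(E_n) w` is the integral at `u` of `star f` cut off to `E_n`; hence `u ∈ D_{star f}` by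
Fatou's lemma, and `n → ∞` yields `w = (∫ star f dPL) u`. Closedness follows because adjoints are
closed.

An everywhere defined `∫ f dPL` is bounded by the closed graph theorem, whereas
`‖(∫ f dPL) v‖ ≥ k ‖v‖` for `v` in the range of `P({|f| > k})`; so this range is `0` for large `k`.
-/

namespace QuaternionicIntegral

/-! ### Convergence of functions in `L^p` -/

section Lp

variable {α E : Type*} [MeasurableSpace α] {μ : Measure α} [NormedAddCommGroup E] {p : ℝ≥0∞}

theorem eLpNorm_two_sq (f : α → E) : eLpNorm f 2 μ ^ 2 = ∫⁻ x, ‖f x‖ₑ ^ 2 ∂μ := by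
  simpa using eLpNorm_nnreal_pow_eq_lintegral (μ := μ) (f := f) (p := 2) two_ne_zero

theorem tendsto_eLpNorm_sub_of_tendstoUniformly [IsFiniteMeasure μ] {F : ℕ → α → E} {f : α → E}
    (h : TendstoUniformly F f atTop) :
    Tendsto (fun n => eLpNorm (F n - f) p μ) atTop (𝓝 0) := by
  have hbound : Tendsto (fun ε : ℝ => μ Set.univ ^ p.toReal⁻¹ * ENNReal.ofReal ε) (𝓝 0) (𝓝 0) := by
    have hfin : μ Set.univ ^ p.toReal⁻¹ ≠ ∞ :=
      ENNReal.rpow_ne_top_of_nonneg (by positivity) (measure_ne_top μ _)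
    simpa using
      ENNReal.Tendsto.const_mul (ENNReal.tendsto_ofReal (tendsto_id (x := 𝓝 (0 : ℝ)))) (.inr hfin)
  refine ENNReal.tendsto_nhds_zero.mpr fun δ hδ => ?_
  obtain ⟨ε, hεδ, hε⟩ := (((hbound.mono_left nhdsWithin_le_nhds).eventually (Iic_mem_nhds hδ)).and
    (self_mem_nhdsWithin (s := Set.Ioi (0 : ℝ)))).exists
  filter_upwards [Metric.tendstoUniformly_iff.mp h ε hε] with n hn
  refine (eLpNorm_le_of_ae_bound (.of_forall fun x => ?_)).trans hεδ
  simpa only [Pi.sub_apply, dist_comm (f x), dist_eq_norm] using (hn x).le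

theorem tendsto_eLpNorm_indicator_sub (hp : p ≠ ∞) {f : α → E} (hf : MemLp f p μ)
    {A : ℕ → Set α} (hA : ∀ n, MeasurableSet (A n)) (hAf : ∀ x, ∀ᶠ n in atTop, x ∈ A n) :
    Tendsto (fun n => eLpNorm ((A n).indicator f - f) p μ) atTop (𝓝 0) := by
  rcases eq_or_ne p 0 with rfl | hp0
  · simp
  have hpos := ENNReal.toReal_pos hp0 hp
  have hle (n : ℕ) (x : α) : ‖((A n).indicator f - f) x‖ₑ ≤ ‖f x‖ₑ := by
    by_cases hx : x ∈ A n <;> simp [hx]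
  have hlint : Tendsto (fun n => ∫⁻ x, ‖((A n).indicator f - f) x‖ₑ ^ p.toReal ∂μ) atTop
      (𝓝 (∫⁻ _, 0 ∂μ)) := by
    refine tendsto_lintegral_of_dominated_convergence' (fun x => ‖f x‖ₑ ^ p.toReal)
      (fun n => ?_) (fun n => .of_forall fun x => ?_)
      (lintegral_rpow_enorm_lt_top_of_eLpNorm_lt_top hp0 hp hf.2).ne (.of_forall fun x => ?_)
    · exact ((hf.1.indicator (hA n)).sub hf.1).enorm.pow_const _
    · exact ENNReal.rpow_le_rpow (hle n x) hpos.le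
    · refine tendsto_const_nhds.congr' ?_
      filter_upwards [hAf x] with n hn
      simp [hn, hpos]
  simp only [eLpNorm_eq_lintegral_rpow_enorm_toReal hp0 hp]
  simpa [hpos] using hlint.ennrpow_const (1 / p.toReal)

theorem eLpNorm_le_of_eLpNorm_indicator_le {f : α → E} (hf : AEStronglyMeasurable f μ)
    {A : ℕ → Set α} (hA : ∀ n, MeasurableSet (A n)) (hAf : ∀ x, ∀ᶠ n in atTop, x ∈ A n) {C : ℝ≥0∞}
    (hC : ∀ n, eLpNorm ((A n).indicator f) p μ ≤ C) : eLpNorm f p μ ≤ C := by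
  refine Lp.eLpNorm_le_of_ae_tendsto (u := atTop) (.of_forall hC) (fun n => hf.indicator (hA n))
    (.of_forall fun x => tendsto_const_nhds.congr' ?_)
  filter_upwards [hAf x] with n hn
  rw [Set.indicator_of_mem hn]

theorem exists_simpleFunc_tendsto_eLpNorm_sub (hp : p ≠ ∞) {f : α → E} (hf : MemLp f p μ) :
    ∃ s : ℕ → SimpleFunc α E, Tendsto (fun n => eLpNorm (⇑(s n) - f) p μ) atTop (𝓝 0) := by
  have hε (n : ℕ) : ((n : ℝ≥0∞)⁻¹) ≠ 0 := ENNReal.inv_ne_zero.mpr (ENNReal.natCast_ne_top n)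
  choose s hs _ using fun n => hf.exists_simpleFunc_eLpNorm_sub_lt hp (hε n)
  refine ⟨s, tendsto_of_tendsto_of_tendsto_of_le_of_le tendsto_const_nhds
    ENNReal.tendsto_inv_nat_nhds_zero (fun n => zero_le) fun n => ?_⟩
  rw [eLpNorm_sub_comm]
  exact (hs n).le

theorem tendsto_eLpNorm_of_tendsto_eLpNorm_sub (hp : 1 ≤ p) {F : ℕ → α → E} {f : α → E}
    (hF : ∀ n, MemLp (F n) p μ) (hf : MemLp f p μ)
    (h : Tendsto (fun n => eLpNorm (F n - f) p μ) atTop (𝓝 0)) :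
    Tendsto (fun n => eLpNorm (F n) p μ) atTop (𝓝 (eLpNorm f p μ)) := by
  have : Fact (1 ≤ p) := ⟨hp⟩
  simpa only [Lp.enorm_toLp] using
    ((Lp.tendsto_Lp_iff_tendsto_eLpNorm'' F hF f hf).mpr h).enorm

theorem exists_simpleFunc_tendstoUniformly [ProperSpace E] [MeasurableSpace E]
    [OpensMeasurableSpace E] {f : α → E} (hf : Measurable f) (hb : ∃ C, ∀ x, ‖f x‖ ≤ C) :
    ∃ s : ℕ → SimpleFunc α E, TendstoUniformly (fun n => ⇑(s n)) f atTop := by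
  obtain ⟨C, hC⟩ := hb
  let e := TopologicalSpace.denseSeq E
  refine ⟨fun n => (SimpleFunc.nearestPt e n).comp f hf,
    EMetric.tendstoUniformly_iff.mpr fun ε hε => ?_⟩
  obtain ⟨t, ht⟩ := (isCompact_closedBall (0 : E) C).elim_finite_subcover
    (fun k => Metric.eball (e k) ε) (fun _ => Metric.isOpen_eball) fun y _ => by
      obtain ⟨k, hk⟩ := (TopologicalSpace.denseRange_denseSeq E).exists_mem_open
        Metric.isOpen_eball ⟨y, Metric.mem_eball_self hε⟩
      exact Set.mem_iUnion.mpr ⟨k, Metric.mem_eball_comm.mp hk⟩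
  filter_upwards [eventually_ge_atTop (t.sup id)] with n hn x
  obtain ⟨k, hkt, hk⟩ := Set.mem_iUnion₂.mp (ht (mem_closedBall_zero_iff.mpr (hC x)))
  rw [edist_comm]
  exact (SimpleFunc.edist_nearestPt_le e (f x) ((Finset.le_sup (f := id) hkt).trans hn)).trans_lt
    (Metric.mem_eball_comm.mp hk)

end Lp

section Sublevel

variable {α E : Type*} [NormedAddCommGroup E]

/-- The set `{|f| ≤ n}`, to which an unbounded function `f` is cut off. -/
def sublevel (f : α → E) (n : ℕ) : Set α := {x | ‖f x‖ ≤ n}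

theorem measurableSet_sublevel [MeasurableSpace α] [MeasurableSpace E] [OpensMeasurableSpace E]
    {f : α → E} (hf : Measurable f) (n : ℕ) : MeasurableSet (sublevel f n) :=
  measurableSet_le hf.norm measurable_const

theorem eventually_mem_sublevel (f : α → E) (x : α) : ∀ᶠ n in atTop, x ∈ sublevel f n := by
  filter_upwards [eventually_ge_atTop ⌈‖f x‖⌉₊] with n hn
  exact Nat.ceil_le.mp hn

theorem norm_indicator_sublevel_le (f : α → E) (n : ℕ) (x : α) :
    ‖(sublevel f n).indicator f x‖ ≤ n := by
  by_cases hx : x ∈ sublevel f n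
  · rwa [Set.indicator_of_mem hx]
  · simp [hx]

end Sublevel

section Star

variable {α R : Type*}

theorem indicator_star [AddMonoid R] [StarAddMonoid R] (E : Set α) (f : α → R) :
    E.indicator (star f) = star (E.indicator f) :=
  Set.indicator_comp_of_zero (star_zero R)

theorem measurable_star [MeasurableSpace α] [TopologicalSpace R] [MeasurableSpace R]
    [BorelSpace R] [Star R] [ContinuousStar R] {f : α → R} (hf : Measurable f) :
    Measurable (star f) :=
  continuous_star.measurable.comp hf

end Star

/-! ### Quaternionic Hilbert spaces -/

section Hilbert

variable {H : Type*} [NormedAddCommGroup H] [Module ℍ[ℝ]ᵐᵒᵖ H] [QInnerProductSpace H]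

theorem re_qinner_self (u : H) : (qinner u u).re = ‖u‖ ^ 2 := by
  rw [qinner_self, Quaternion.re_coe]

theorem re_qinner_le (u v : H) : (qinner u v).re ≤ ‖u‖ * ‖v‖ := by
  have hadd : ‖u + v‖ ^ 2 ≤ (‖u‖ + ‖v‖) ^ 2 := by gcongr; exact norm_add_le u v
  have hsub : (‖u‖ - ‖v‖) ^ 2 ≤ ‖u - v‖ ^ 2 := sq_le_sq.mpr <| by
    simpa only [abs_norm] using abs_norm_sub_norm_le u v
  rw [re_qinner_eq]
  linarith

theorem norm_qinner_le (u v : H) : ‖qinner u v‖ ≤ ‖u‖ * ‖v‖ := by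
  set q := qinner u v
  rcases (norm_nonneg q).eq_or_lt with hq | hq
  · rw [← hq]; positivity
  refine le_of_mul_le_mul_left ?_ hq
  calc ‖q‖ * ‖q‖ = (qinner u (MulOpposite.op (star q) • v)).re := by
        rw [qinner_smul_right, Quaternion.self_mul_star, Quaternion.re_coe,
          Quaternion.normSq_eq_norm_mul_self]
    _ ≤ ‖u‖ * (‖q‖ * ‖v‖) := by
        simpa only [norm_qsmul, MulOpposite.unop_op, norm_star] using
          re_qinner_le u (MulOpposite.op (star q) • v)
    _ = ‖q‖ * (‖u‖ * ‖v‖) := by ring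

/-- The scalar product `⟨u | ·⟩` as an additive map. -/
def qinnerAddHom (u : H) : H →+ ℍ[ℝ] := AddMonoidHom.mk' (qinner u) (qinner_add_right u)

@[simp]
theorem qinnerAddHom_apply (u v : H) : qinnerAddHom u v = qinner u v := rfl

theorem continuous_qinner_right (u : H) : Continuous fun v : H => qinner u v :=
  AddMonoidHomClass.continuous_of_bound (qinnerAddHom u) ‖u‖ (norm_qinner_le u)

theorem continuous_qinner_left (v : H) : Continuous fun u : H => qinner u v := by
  simp only [qinner_conj _ v]
  exact (continuous_qinner_right v).star

theorem qinner_sum_right {α : Type*} (s : Finset α) (u : H) (w : α → H) :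
    qinner u (∑ x ∈ s, w x) = ∑ x ∈ s, qinner u (w x) :=
  map_sum (qinnerAddHom u) w s

theorem qinner_sum_left {α : Type*} (s : Finset α) (u : H) (w : α → H) :
    qinner (∑ x ∈ s, w x) u = ∑ x ∈ s, qinner (w x) u := by
  rw [qinner_conj, qinner_sum_right, star_sum]
  simp only [← qinner_conj]

theorem ext_qinner_left {u v : H} (h : ∀ w, qinner u w = qinner v w) : u = v := by
  have hself : (qinner (u - v) (u - v)).re = 0 := by
    rw [qinner_sub_left, h, sub_self, Quaternion.re_zero]
  rw [re_qinner_self] at hself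
  exact sub_eq_zero.mp (norm_eq_zero.mp (pow_eq_zero_iff two_ne_zero |>.mp hself))

theorem eq_zero_of_forall_star_mul_eq {x : ℍ[ℝ]} (h : ∀ q, star (x * q) = x * q) : x = 0 := by
  obtain ⟨-, hxI, hxJ, hxK⟩ := Quaternion.ext_iff.mp (h 1)
  simp only [mul_one, Quaternion.imI_star, Quaternion.imJ_star, Quaternion.imK_star,
    neg_eq_self] at hxI hxJ hxK
  obtain ⟨i, hi⟩ : ∃ i : ℍ[ℝ], i.imI = 1 := ⟨⟨0, 1, 0, 0⟩, rfl⟩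
  have hxre := congrArg QuaternionAlgebra.imI (h i)
  simp only [Quaternion.imI_star, neg_eq_self, Quaternion.imI_mul, hi, hxI, hxJ, hxK, mul_one,
    zero_mul, add_zero, sub_zero] at hxre
  exact Quaternion.ext_iff.mpr ⟨hxre, hxI, hxJ, hxK⟩

theorem qinner_apply_comm_of_diagonal {T : H →L[ℍ[ℝ]ᵐᵒᵖ] H}
    (hT : ∀ u, qinner (T u) u = qinner u (T u)) (u v : H) :
    qinner (T u) v = qinner u (T v) := by
  refine (sub_eq_zero.mp (eq_zero_of_forall_star_mul_eq fun q => ?_)).symm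
  have hpolar := hT (u + MulOpposite.op q • v)
  simp only [map_add, map_smul, qinner_add_left, qinner_add_right, qinner_smul_left,
    qinner_smul_right, hT u, hT v, add_mul, add_assoc] at hpolar
  rw [star_mul, star_sub, ← qinner_conj, ← qinner_conj, mul_sub, sub_mul,
    sub_eq_sub_iff_add_eq_add, add_comm (qinner u (T v) * q)]
  refine add_right_cancel (b := star q * qinner v (T v) * q) ?_
  simpa only [add_assoc] using add_left_cancel hpolar

end Hilbert

section LeftScalarMul

variable {H : Type*} [NormedAddCommGroup H] [Module ℍ[ℝ]ᵐᵒᵖ H] [QInnerProductSpace H]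
  {L : ℍ[ℝ] → (H →L[ℍ[ℝ]ᵐᵒᵖ] H)}

theorem IsHilbertBasis.ext {N : Set H} (hN : IsHilbertBasis N) {u v : H}
    (h : ∀ z ∈ N, qinner z u = qinner z v) : u = v := by
  refine sub_eq_zero.mp (hN.eq_zero_of_orthogonal _ fun z hz => ?_)
  rw [qinner_conj, qinner_sub_right, h z hz, sub_self, star_zero]

theorem IsLeftScalarMul.exists_basis (hL : IsLeftScalarMul L) :
    ∃ N : Set H, IsHilbertBasis N ∧ ∀ q u, ∀ z ∈ N, qinner z (L q u) = q * qinner z u := by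
  obtain ⟨N, hN, h⟩ := hL
  refine ⟨N, hN, fun q u z hz => ?_⟩
  have hsum := (h q u).map (qinnerAddHom z) (continuous_qinner_right z)
  refine hsum.unique ?_
  convert hasSum_single (⟨z, hz⟩ : N) fun z' hz' => ?_
  · simp only [Function.comp_apply, qinnerAddHom_apply, qinner_smul_right, qinner_self,
      hN.norm_eq_one z hz, one_pow, Quaternion.coe_one, one_mul]
  · rw [Function.comp_apply, qinnerAddHom_apply, qinner_smul_right,
      hN.orthogonal z hz z' z'.2 fun he => hz' (Subtype.ext he.symm), zero_mul]

theorem IsLeftScalarMul.mul (hL : IsLeftScalarMul L) (p q : ℍ[ℝ]) (u : H) :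
    L (p * q) u = L p (L q u) := by
  obtain ⟨N, hN, h⟩ := hL.exists_basis
  exact hN.ext fun z hz => by simp only [h _ _ z hz, mul_assoc]

theorem IsLeftScalarMul.add (hL : IsLeftScalarMul L) (p q : ℍ[ℝ]) (u : H) :
    L (p + q) u = L p u + L q u := by
  obtain ⟨N, hN, h⟩ := hL.exists_basis
  exact hN.ext fun z hz => by simp only [qinner_add_right, h _ _ z hz, add_mul]

theorem IsLeftScalarMul.coe (hL : IsLeftScalarMul L) (r : ℝ) (u : H) :
    L (r : ℍ[ℝ]) u = MulOpposite.op (r : ℍ[ℝ]) • u := by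
  obtain ⟨N, hN, h⟩ := hL.exists_basis
  exact hN.ext fun z hz => by rw [h _ _ z hz, qinner_smul_right, Quaternion.coe_commutes]

theorem IsLeftScalarMul.qinner_left (hL : IsLeftScalarMul L) (q : ℍ[ℝ]) (u v : H) :
    qinner (L q u) v = qinner u (L (star q) v) := by
  obtain ⟨N, -, h⟩ := hL
  have hleft := ((h q u).map (qinnerAddHom v) (continuous_qinner_right v)).star
  have hright := (h (star q) v).map (qinnerAddHom u) (continuous_qinner_right u)
  rw [qinner_conj]
  refine hleft.unique (hright.congr_fun fun z => ?_)
  simp only [Function.comp_apply, qinnerAddHom_apply, qinner_smul_right, star_mul, ← qinner_conj,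
    mul_assoc]

end LeftScalarMul

/-! ### Operators with a domain -/

section Operators

variable {H : Type*} [NormedAddCommGroup H] [Module ℍ[ℝ]ᵐᵒᵖ H] {T S : H →ₗ.[ℍ[ℝ]ᵐᵒᵖ] H} {u w : H}

theorem mem_graph_opComp [QInnerProductSpace H] :
    (u, w) ∈ (opComp T S).graph ↔ ∃ v, (u, v) ∈ S.graph ∧ (v, w) ∈ T.graph := by
  simp only [LinearPMap.mem_graph_iff]
  constructor
  · rintro ⟨⟨x, ⟨y, hy, rfl⟩, _⟩, rfl, rfl⟩
    exact ⟨S y, ⟨y, rfl, rfl⟩, ⟨S y, hy⟩, rfl, rfl⟩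
  · rintro ⟨_, ⟨y, rfl, rfl⟩, ⟨⟨_, hz⟩, rfl, rfl⟩⟩
    exact ⟨⟨y, ⟨y, hz, rfl⟩, y.2⟩, rfl, rfl⟩

theorem mem_graph_add :
    (u, w) ∈ (T + S).graph ↔ ∃ v v', (u, v) ∈ T.graph ∧ (u, v') ∈ S.graph ∧ v + v' = w := by
  simp only [LinearPMap.mem_graph_iff]
  constructor
  · rintro ⟨⟨x, hxT, hxS⟩, rfl, rfl⟩
    exact ⟨_, _, ⟨⟨x, hxT⟩, rfl, rfl⟩, ⟨⟨x, hxS⟩, rfl, rfl⟩, rfl⟩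
  · rintro ⟨_, _, ⟨⟨_, hxT⟩, rfl, rfl⟩, ⟨⟨_, hxS⟩, rfl, rfl⟩, rfl⟩
    exact ⟨⟨_, hxT, hxS⟩, rfl, rfl⟩

theorem mem_graph_domRestrict {D : Submodule ℍ[ℝ]ᵐᵒᵖ H} :
    (u, w) ∈ (T.domRestrict D).graph ↔ u ∈ D ∧ (u, w) ∈ T.graph := by
  simp only [LinearPMap.mem_graph_iff]
  constructor
  · rintro ⟨⟨x, hxD, hxT⟩, rfl, rfl⟩
    exact ⟨hxD, ⟨x, hxT⟩, rfl, rfl⟩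
  · rintro ⟨hxD, ⟨⟨x, hxT⟩, rfl, rfl⟩⟩
    exact ⟨⟨x, hxD, hxT⟩, rfl, rfl⟩

theorem domRestrict_eq_self_iff {D : Submodule ℍ[ℝ]ᵐᵒᵖ H} :
    T.domRestrict D = T ↔ T.domain ≤ D := by
  rw [← inf_eq_right]
  exact ⟨congrArg LinearPMap.domain, LinearPMap.eq_of_le_of_domain_eq LinearPMap.domRestrict_le⟩

theorem isClosed_adjointGraph [QInnerProductSpace H] (T : H →ₗ.[ℍ[ℝ]ᵐᵒᵖ] H) :
    IsClosed (adjointGraph T : Set (H × H)) := by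
  have hinter : (adjointGraph T : Set (H × H)) =
      ⋂ v : T.domain, {p | qinner p.2 (v : H) = qinner p.1 (T v)} := by
    ext p
    simp only [Set.mem_iInter]
    rfl
  rw [hinter]
  exact isClosed_iInter fun v => isClosed_eq ((continuous_qinner_left _).comp continuous_snd)
    ((continuous_qinner_left _).comp continuous_fst)

end Operators

section ClosedGraph

variable {H : Type*} [NormedAddCommGroup H] [Module ℍ[ℝ]ᵐᵒᵖ H] [QInnerProductSpace H]

/-- The real normed space underlying a quaternionic Hilbert space; it makes the closed graph theorem
available, which is not stated for modules over a division ring. -/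
noncomputable abbrev realNormedSpace (H : Type*) [NormedAddCommGroup H] [Module ℍ[ℝ]ᵐᵒᵖ H]
    [QInnerProductSpace H] : NormedSpace ℝ H :=
  letI : Module ℝ H := Module.compHom H (algebraMap ℝ ℍ[ℝ]ᵐᵒᵖ)
  { norm_smul_le := fun r u => by
      change ‖algebraMap ℝ ℍ[ℝ]ᵐᵒᵖ r • u‖ ≤ _
      rw [norm_qsmul]
      simp [MulOpposite.algebraMap_apply] }

theorem OpIsClosed.exists_norm_le [CompleteSpace H] {T : H →ₗ.[ℍ[ℝ]ᵐᵒᵖ] H} (hT : OpIsClosed T)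
    (hdom : T.domain = ⊤) : ∃ M : ℝ, ∀ u w, (u, w) ∈ T.graph → ‖w‖ ≤ M * ‖u‖ := by
  let := realNormedSpace H
  let A : H →ₗ[ℍ[ℝ]ᵐᵒᵖ] H := T.toFun ∘ₗ (LinearEquiv.ofTop T.domain hdom).symm
  let A' : H →ₗ[ℝ] H :=
    { toFun := A
      map_add' := A.map_add
      map_smul' := fun r u => A.map_smul (algebraMap ℝ ℍ[ℝ]ᵐᵒᵖ r) u }
  have hgraph : (A'.graph : Set (H × H)) = T.graph := by
    ext ⟨u, w⟩
    rw [SetLike.mem_coe, SetLike.mem_coe, LinearMap.mem_graph_iff, LinearPMap.mem_graph_iff]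
    refine ⟨fun h => ⟨⟨u, hdom ▸ trivial⟩, rfl, h.symm⟩, ?_⟩
    rintro ⟨u, rfl, rfl⟩
    rfl
  let B : H →L[ℝ] H := ⟨A', A'.continuous_of_isClosed_graph (hgraph ▸ hT)⟩
  refine ⟨‖B‖, fun u w h => ?_⟩
  obtain rfl : w = B u := (A'.mem_graph_iff _).mp (hgraph.symm.subset h)
  exact B.le_opNorm u

end ClosedGraph

namespace IqPVM

variable {ι : ℍ[ℝ]} {H : Type*} [NormedAddCommGroup H] [Module ℍ[ℝ]ᵐᵒᵖ H] [QInnerProductSpace H]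
  (PL : IqPVM ι H)

theorem qinner_P_left {E : Set (halfPlane ι)} (hE : MeasurableSet E) (u v : H) :
    qinner (PL.P E u) v = qinner u (PL.P E v) := by
  refine qinner_apply_comm_of_diagonal (fun w => ?_) u v
  obtain ⟨r, -, hr⟩ := PL.P_nonneg E hE w
  rw [qinner_conj, hr, Quaternion.star_coe]

theorem P_P_apply {E F : Set (halfPlane ι)} (hE : MeasurableSet E) (hF : MeasurableSet F) (u : H) :
    PL.P E (PL.P F u) = PL.P (E ∩ F) u :=
  DFunLike.congr_fun (PL.P_inter E F hE hF) u

theorem P_L_apply {E : Set (halfPlane ι)} (hE : MeasurableSet E) (q : ℍ[ℝ]) (u : H) :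
    PL.P E (PL.L q u) = PL.L q (PL.P E u) :=
  DFunLike.congr_fun (PL.P_comm E hE q) u

theorem measure_eq_enorm_sq (u : H) {E : Set (halfPlane ι)} (hE : MeasurableSet E) :
    PL.measure u E = ‖PL.P E u‖ₑ ^ 2 := by
  rw [PL.measure_apply u hE, ← ofReal_norm, ← ENNReal.ofReal_pow (norm_nonneg _), ← re_qinner_self,
    PL.qinner_P_left hE, PL.P_P_apply hE hE, Set.inter_self]

theorem measure_univ (u : H) : PL.measure u Set.univ = ‖u‖ₑ ^ 2 := by
  rw [PL.measure_eq_enorm_sq u MeasurableSet.univ, PL.P_univ, ContinuousLinearMap.id_apply]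

instance isFiniteMeasure_measure (u : H) : IsFiniteMeasure (PL.measure u) :=
  ⟨by rw [PL.measure_univ]; finiteness⟩

open scoped Classical in
/-- The vector measure `E ↦ P(E) u`. Vector measures vanish on non-measurable sets, where the values
of `P` are arbitrary. -/
noncomputable def vectorMeasure (u : H) : VectorMeasure (halfPlane ι) H where
  measureOf' E := if MeasurableSet E then PL.P E u else 0
  empty' := by rw [if_pos MeasurableSet.empty, PL.P_empty_apply]
  not_measurable' _ hE := if_neg hE
  m_iUnion' E hE hd := by
    simpa only [if_pos (hE _), if_pos (MeasurableSet.iUnion hE)] using PL.P_iUnion E hE hd u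

theorem vectorMeasure_apply (u : H) {E : Set (halfPlane ι)} (hE : MeasurableSet E) :
    PL.vectorMeasure u E = PL.P E u :=
  if_pos hE

/-! ### The integral of simple functions -/

theorem integralSimple_apply_of_subset (s : SimpleFunc (halfPlane ι) ℍ[ℝ]) {F : Finset ℍ[ℝ]}
    (hF : s.range ⊆ F) (u : H) :
    PL.integralSimple s u = ∑ x ∈ F, PL.L x (PL.P (s ⁻¹' {x}) u) := by
  simp only [integralSimple, sum_apply, ContinuousLinearMap.comp_apply]
  refine Finset.sum_subset hF fun x _ hx => ?_
  rw [SimpleFunc.preimage_eq_empty_iff _ _ |>.mpr hx, P_empty_apply, map_zero]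

theorem integralSimple_apply (s : SimpleFunc (halfPlane ι) ℍ[ℝ]) (u : H) :
    PL.integralSimple s u = ∑ x ∈ s.range, PL.L x (PL.P (s ⁻¹' {x}) u) :=
  PL.integralSimple_apply_of_subset s subset_rfl u

theorem integralSimple_map_apply_of_subset {β : Type*} (r : SimpleFunc (halfPlane ι) β)
    (φ : β → ℍ[ℝ]) {F : Finset β} (hF : r.range ⊆ F) (u : H) :
    PL.integralSimple (r.map φ) u = ∑ b ∈ F, PL.L (φ b) (PL.P (r ⁻¹' {b}) u) := by
  classical
  have hfiber (x : ℍ[ℝ]) : PL.P (r.map φ ⁻¹' {x}) u = ∑ b ∈ F with φ b = x, PL.P (r ⁻¹' {b}) u := by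
    have hpre : r.map φ ⁻¹' {x} = ⋃ b ∈ F.filter (φ · = x), r ⁻¹' {b} := by
      ext q
      simpa using fun _ => hF (r.mem_range_self q)
    rw [hpre, ← PL.vectorMeasure_apply u (Finset.measurableSet_biUnion _ fun _ _ =>
        r.measurableSet_preimage _), VectorMeasure.of_biUnion_finset]
    · exact Finset.sum_congr rfl fun b _ => PL.vectorMeasure_apply u (r.measurableSet_preimage _)
    · exact fun b _ b' _ hb => (Set.disjoint_singleton.mpr hb).preimage r
    · exact fun b _ => r.measurableSet_preimage _
  have hrange : (r.map φ).range ⊆ F.image φ := by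
    rw [SimpleFunc.range_map]
    exact Finset.image_subset_image hF
  rw [PL.integralSimple_apply_of_subset _ hrange,
    ← Finset.sum_fiberwise_of_maps_to fun b hb => Finset.mem_image_of_mem φ hb]
  refine Finset.sum_congr rfl fun x _ => ?_
  rw [hfiber, map_sum]
  exact Finset.sum_congr rfl fun b hb => by rw [(Finset.mem_filter.mp hb).2]

theorem integralSimple_map_apply {β : Type*} (r : SimpleFunc (halfPlane ι) β) (φ : β → ℍ[ℝ])
    (u : H) : PL.integralSimple (r.map φ) u = ∑ b ∈ r.range, PL.L (φ b) (PL.P (r ⁻¹' {b}) u) :=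
  PL.integralSimple_map_apply_of_subset r φ subset_rfl u

theorem integralSimple_add (s t : SimpleFunc (halfPlane ι) ℍ[ℝ]) (u : H) :
    PL.integralSimple (s + t) u = PL.integralSimple s u + PL.integralSimple t u := by
  have hs := PL.integralSimple_map_apply (s.pair t) Prod.fst u
  have ht := PL.integralSimple_map_apply (s.pair t) Prod.snd u
  rw [SimpleFunc.map_fst_pair] at hs
  rw [SimpleFunc.map_snd_pair] at ht
  rw [SimpleFunc.add_eq_map₂, integralSimple_map_apply, hs, ht, ← Finset.sum_add_distrib]
  exact Finset.sum_congr rfl fun p _ => PL.isLeftScalarMul.add _ _ _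

theorem integralSimple_mul (s t : SimpleFunc (halfPlane ι) ℍ[ℝ]) (u : H) :
    PL.integralSimple (s * t) u = PL.integralSimple s (PL.integralSimple t u) := by
  have hrange : (s.pair t).range ⊆ s.range ×ˢ t.range := fun p hp => by
    obtain ⟨x, rfl⟩ := SimpleFunc.mem_range.mp hp
    exact Finset.mk_mem_product (s.mem_range_self x) (t.mem_range_self x)
  rw [SimpleFunc.mul_eq_map₂, PL.integralSimple_map_apply_of_subset _ _ hrange, Finset.sum_product,
    integralSimple_apply]
  refine Finset.sum_congr rfl fun x _ => ?_
  rw [integralSimple_apply, map_sum, map_sum]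
  refine Finset.sum_congr rfl fun y _ => ?_
  rw [PL.isLeftScalarMul.mul, PL.P_L_apply (s.measurableSet_preimage _),
    PL.P_P_apply (s.measurableSet_preimage _) (t.measurableSet_preimage _),
    SimpleFunc.pair_preimage_singleton]

theorem qinner_integralSimple_left (s : SimpleFunc (halfPlane ι) ℍ[ℝ]) (u v : H) :
    qinner (PL.integralSimple s u) v = qinner u (PL.integralSimple (s.map star) v) := by
  rw [integralSimple_map_apply, integralSimple_apply, qinner_sum_left, qinner_sum_right]
  refine Finset.sum_congr rfl fun x _ => ?_
  rw [PL.isLeftScalarMul.qinner_left, PL.qinner_P_left (s.measurableSet_preimage _),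
    PL.P_L_apply (s.measurableSet_preimage _)]

theorem re_qinner_integralSimple_map_coe {β : Type*} (r : SimpleFunc (halfPlane ι) β) (φ : β → ℝ)
    (u : H) : (qinner u (PL.integralSimple (r.map fun b => (φ b : ℍ[ℝ])) u)).re =
      ∑ b ∈ r.range, φ b * (qinner u (PL.P (r ⁻¹' {b}) u)).re := by
  rw [integralSimple_map_apply, qinner_sum_right]
  refine (map_sum (QuaternionAlgebra.reₗ (-1 : ℝ) 0 (-1)) _ _).trans
    (Finset.sum_congr rfl fun b _ => ?_)
  rw [PL.isLeftScalarMul.coe, qinner_smul_right, Quaternion.mul_coe_eq_smul]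
  rfl

theorem enorm_integralSimple_sq (s : SimpleFunc (halfPlane ι) ℍ[ℝ]) (u : H) :
    ‖PL.integralSimple s u‖ₑ ^ 2 = ∫⁻ x, ‖s x‖ₑ ^ 2 ∂PL.measure u := by
  have hstar_mul : s.map star * s = s.map fun x => ((‖x‖ ^ 2 : ℝ) : ℍ[ℝ]) := by
    ext1 x
    rw [SimpleFunc.mul_apply, SimpleFunc.map_apply, SimpleFunc.map_apply, Quaternion.star_mul_self,
      Quaternion.normSq_eq_norm_mul_self, pow_two]
  have hnorm : ‖PL.integralSimple s u‖ ^ 2 =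
      ∑ x ∈ s.range, ‖x‖ ^ 2 * (qinner u (PL.P (s ⁻¹' {x}) u)).re := by
    rw [← re_qinner_self, qinner_integralSimple_left, ← integralSimple_mul, hstar_mul,
      re_qinner_integralSimple_map_coe]
  have hlint : ∫⁻ x, ‖s x‖ₑ ^ 2 ∂PL.measure u =
      ∑ x ∈ s.range, ‖x‖ₑ ^ 2 * PL.measure u (s ⁻¹' {x}) := by
    rw [← SimpleFunc.map_lintegral, ← SimpleFunc.lintegral_eq_lintegral]
    simp only [SimpleFunc.map_apply]
  rw [hlint, ← ofReal_norm, ← ENNReal.ofReal_pow (norm_nonneg _), hnorm,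
    ENNReal.ofReal_sum_of_nonneg fun x _ =>
      mul_nonneg (by positivity) (PL.re_nonneg (s.measurableSet_preimage _) u)]
  refine Finset.sum_congr rfl fun x _ => ?_
  rw [ENNReal.ofReal_mul (by positivity), PL.measure_apply u (s.measurableSet_preimage _),
    ENNReal.ofReal_pow (norm_nonneg _), ofReal_norm]

theorem enorm_integralSimple (s : SimpleFunc (halfPlane ι) ℍ[ℝ]) (u : H) :
    ‖PL.integralSimple s u‖ₑ = eLpNorm s 2 (PL.measure u) :=
  (ENNReal.pow_right_strictMono two_ne_zero).injective <| by
    rw [enorm_integralSimple_sq, eLpNorm_two_sq]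

theorem integralSimple_neg (s : SimpleFunc (halfPlane ι) ℍ[ℝ]) (u : H) :
    PL.integralSimple (-s) u = -PL.integralSimple s u := by
  refine eq_neg_of_add_eq_zero_left ?_
  rw [← integralSimple_add, neg_add_cancel, ← enorm_eq_zero, enorm_integralSimple]
  exact eLpNorm_zero

theorem integralSimple_sub (s t : SimpleFunc (halfPlane ι) ℍ[ℝ]) (u : H) :
    PL.integralSimple (s - t) u = PL.integralSimple s u - PL.integralSimple t u := by
  rw [sub_eq_add_neg, integralSimple_add, integralSimple_neg, sub_eq_add_neg]

theorem integralSimple_restrict_const_one {E : Set (halfPlane ι)} (hE : MeasurableSet E) (u : H) :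
    PL.integralSimple ((SimpleFunc.const _ 1).restrict E) u = PL.P E u := by
  classical
  have hrange : ((SimpleFunc.const (halfPlane ι) 1).restrict E).range ⊆ ({0, 1} : Finset ℍ[ℝ]) :=
    fun x hx => by
      obtain ⟨q, rfl⟩ := SimpleFunc.mem_range.mp hx
      by_cases hq : q ∈ E <;> simp [hE, hq]
  have hL_zero (v : H) : PL.L 0 v = 0 := by simpa using PL.isLeftScalarMul.coe 0 v
  have hL_one (v : H) : PL.L 1 v = v := by simpa using PL.isLeftScalarMul.coe 1 v
  have hpre : (SimpleFunc.const (halfPlane ι) (1 : ℍ[ℝ])).restrict E ⁻¹' {1} = E := by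
    rw [SimpleFunc.restrict_preimage_singleton _ hE one_ne_zero]
    exact Set.inter_eq_left.mpr fun _ _ => rfl
  rw [PL.integralSimple_apply_of_subset _ hrange, Finset.sum_pair zero_ne_one, hL_zero, hL_one,
    zero_add, hpre]

/-! ### The integral as an isometry on `L²(μ_u)` -/

variable {w w' u v z : H} {f g : halfPlane ι → ℍ[ℝ]}

/-- `w` is the value at `u ∈ D_f` of the isometric extension of `s ↦ ∫ s dPL u` from the simple
functions to `L²(μ_u)`. In this form integrals can be manipulated without reference to the
truncations that define `IqPVM.integral`. -/
def HasIntegral (f : halfPlane ι → ℍ[ℝ]) (u w : H) : Prop :=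
  u ∈ PL.squareDomain f ∧ ∃ s : ℕ → SimpleFunc (halfPlane ι) ℍ[ℝ],
    Tendsto (fun n => eLpNorm (⇑(s n) - f) 2 (PL.measure u)) atTop (𝓝 0) ∧
      Tendsto (fun n => PL.integralSimple (s n) u) atTop (𝓝 w)

theorem mem_squareDomain : u ∈ PL.squareDomain f ↔ MemLp f 2 (PL.measure u) := Iff.rfl

theorem simpleFunc_mem_squareDomain (s : SimpleFunc (halfPlane ι) ℍ[ℝ]) (u : H) :
    u ∈ PL.squareDomain s :=
  s.memLp_of_isFiniteMeasure 2 _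

theorem hasIntegral_simpleFunc (s : SimpleFunc (halfPlane ι) ℍ[ℝ]) (u : H) :
    PL.HasIntegral s u (PL.integralSimple s u) :=
  ⟨PL.simpleFunc_mem_squareDomain s u, fun _ => s, by simp, tendsto_const_nhds⟩

variable {PL}

theorem HasIntegral.enorm_eq (h : PL.HasIntegral f u w) : ‖w‖ₑ = eLpNorm f 2 (PL.measure u) := by
  obtain ⟨hf, s, hsf, hsw⟩ := h
  refine tendsto_nhds_unique hsw.enorm ?_
  simpa only [enorm_integralSimple] using tendsto_eLpNorm_of_tendsto_eLpNorm_sub one_le_two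
    (fun n => PL.simpleFunc_mem_squareDomain (s n) u) hf hsf

theorem HasIntegral.add (hf : PL.HasIntegral f u w) (hg : PL.HasIntegral g u w') :
    PL.HasIntegral (f + g) u (w + w') := by
  obtain ⟨hfu, s, hsf, hsw⟩ := hf
  obtain ⟨hgu, t, htg, htw⟩ := hg
  refine ⟨MemLp.add hfu hgu, fun n => s n + t n, ?_, ?_⟩
  · refine tendsto_of_tendsto_of_tendsto_of_le_of_le tendsto_const_nhds
      (by simpa using hsf.add htg) (fun _ => zero_le) fun n => ?_
    rw [SimpleFunc.coe_add, add_sub_add_comm]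
    exact eLpNorm_add_le ((s n).aestronglyMeasurable.sub hfu.1)
      ((t n).aestronglyMeasurable.sub hgu.1) one_le_two
  · simpa only [integralSimple_add] using hsw.add htw

theorem HasIntegral.neg (hf : PL.HasIntegral f u w) : PL.HasIntegral (-f) u (-w) := by
  obtain ⟨hfu, s, hsf, hsw⟩ := hf
  refine ⟨MemLp.neg hfu, fun n => -s n, hsf.congr fun n => ?_, ?_⟩
  · rw [SimpleFunc.coe_neg, neg_sub_neg, eLpNorm_sub_comm]
  · simpa only [integralSimple_neg] using hsw.neg

theorem HasIntegral.sub (hf : PL.HasIntegral f u w) (hg : PL.HasIntegral g u w') :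
    PL.HasIntegral (f - g) u (w - w') := by
  simpa only [sub_eq_add_neg] using hf.add hg.neg

theorem HasIntegral.unique (h : PL.HasIntegral f u w) (h' : PL.HasIntegral f u w') : w = w' := by
  rw [← sub_eq_zero, ← enorm_eq_zero, (h.sub h').enorm_eq, sub_self, eLpNorm_zero]

theorem HasIntegral.tendsto {F : ℕ → halfPlane ι → ℍ[ℝ]} {W : ℕ → H}
    (hF : ∀ n, PL.HasIntegral (F n) u (W n)) (hf : PL.HasIntegral f u w)
    (h : Tendsto (fun n => eLpNorm (F n - f) 2 (PL.measure u)) atTop (𝓝 0)) :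
    Tendsto W atTop (𝓝 w) := by
  rw [tendsto_iff_edist_tendsto_0]
  simpa only [edist_eq_enorm_sub, ((hF _).sub hf).enorm_eq] using h

theorem HasIntegral.norm_le (hf : PL.HasIntegral f u w) {C : ℝ} (hC : ∀ q, ‖f q‖ ≤ C) :
    ‖w‖ ≤ C * ‖u‖ := by
  have hC0 : 0 ≤ C := (norm_nonneg _).trans (hC ⟨0, 0, 0, le_rfl, by simp⟩)
  have henorm : ‖w‖ₑ ≤ ‖u‖ₑ * ENNReal.ofReal C := by
    rw [hf.enorm_eq]
    refine (eLpNorm_le_of_ae_bound (.of_forall hC)).trans_eq ?_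
    rw [PL.measure_univ, ← ENNReal.rpow_two, ENNReal.toReal_ofNat,
      ENNReal.rpow_rpow_inv two_ne_zero]
  rwa [mul_comm, ← ofReal_norm, ← ofReal_norm, ← ENNReal.ofReal_mul hC0,
    ENNReal.ofReal_le_ofReal_iff (by positivity)] at henorm

theorem mem_squareDomain_of_norm_le (hf : Measurable f) {C : ℝ} (hC : ∀ q, ‖f q‖ ≤ C) (u : H) :
    u ∈ PL.squareDomain f :=
  MemLp.of_bound hf.aestronglyMeasurable C (.of_forall hC)

theorem isBoundedIntegral_iff (hf : Measurable f) (hb : ∃ C, ∀ q, ‖f q‖ ≤ C)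
    {T : H →L[ℍ[ℝ]ᵐᵒᵖ] H} : PL.IsBoundedIntegral f T ↔ ∀ u, PL.HasIntegral f u (T u) := by
  constructor
  · rintro ⟨⟨s, hs⟩, hT⟩ u
    obtain ⟨C, hC⟩ := hb
    refine ⟨mem_squareDomain_of_norm_le hf hC u, s, tendsto_eLpNorm_sub_of_tendstoUniformly hs, ?_⟩
    refine Metric.tendsto_nhds.mpr fun ε hε => ?_
    filter_upwards [hT s hs (ε / (‖u‖ + 1)) (by positivity)] with n hn
    calc dist (PL.integralSimple (s n) u) (T u) ≤ ε / (‖u‖ + 1) * ‖u‖ := by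
          rw [dist_eq_norm]; exact hn u
      _ < ε / (‖u‖ + 1) * (‖u‖ + 1) := by gcongr; exact lt_add_one _
      _ = ε := div_mul_cancel₀ _ (by positivity)
  · refine fun h => ⟨exists_simpleFunc_tendstoUniformly hf hb, fun s hs ε hε => ?_⟩
    filter_upwards [Metric.tendstoUniformly_iff.mp hs ε hε] with n hn u
    refine ((PL.hasIntegral_simpleFunc (s n) u).sub (h u)).norm_le fun q => ?_
    rw [Pi.sub_apply, ← dist_eq_norm, dist_comm]
    exact (hn q).le

theorem truncation_eq_indicator (f : halfPlane ι → ℍ[ℝ]) (n : ℕ) :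
    truncation f n = (sublevel f n).indicator f :=
  rfl

section Complete

variable [CompleteSpace H]

theorem exists_hasIntegral (hu : u ∈ PL.squareDomain f) : ∃ w, PL.HasIntegral f u w := by
  obtain ⟨s, hs⟩ := exists_simpleFunc_tendsto_eLpNorm_sub ENNReal.ofNat_ne_top hu
  have hle (m n : ℕ) : edist (PL.integralSimple (s m) u) (PL.integralSimple (s n) u) ≤
      eLpNorm (⇑(s m) - f) 2 (PL.measure u) + eLpNorm (⇑(s n) - f) 2 (PL.measure u) := by
    rw [edist_eq_enorm_sub, ← integralSimple_sub, enorm_integralSimple, SimpleFunc.coe_sub,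
      eLpNorm_sub_comm (s n) f, ← sub_add_sub_cancel (⇑(s m)) f]
    exact eLpNorm_add_le ((s m).aestronglyMeasurable.sub hu.1)
      (hu.1.sub (s n).aestronglyMeasurable) one_le_two
  have hcauchy : CauchySeq fun n => PL.integralSimple (s n) u := by
    refine EMetric.cauchySeq_iff.mpr fun ε hε => ?_
    obtain ⟨N, hN⟩ := eventually_atTop.mp (hs.eventually (gt_mem_nhds (ENNReal.half_pos hε.ne')))
    exact ⟨N, fun m hm n hn => (hle m n).trans_lt <|
      (ENNReal.add_lt_add (hN m hm) (hN n hn)).trans_eq (ENNReal.add_halves ε)⟩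
  obtain ⟨w, hw⟩ := cauchySeq_tendsto_of_complete hcauchy
  exact ⟨w, hu, s, hs, hw⟩

theorem HasIntegral.of_tendsto {F : ℕ → halfPlane ι → ℍ[ℝ]} {W : ℕ → H}
    (hF : ∀ n, PL.HasIntegral (F n) u (W n)) (hu : u ∈ PL.squareDomain f)
    (h : Tendsto (fun n => eLpNorm (F n - f) 2 (PL.measure u)) atTop (𝓝 0))
    (hW : Tendsto W atTop (𝓝 w)) : PL.HasIntegral f u w := by
  obtain ⟨w', hw'⟩ := exists_hasIntegral hu
  rwa [tendsto_nhds_unique hW (HasIntegral.tendsto hF hw' h)]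

theorem exists_forall_hasIntegral (hf : Measurable f) (hb : ∃ C, ∀ q, ‖f q‖ ≤ C) :
    ∃ T : H →L[ℍ[ℝ]ᵐᵒᵖ] H, ∀ u, PL.HasIntegral f u (T u) := by
  obtain ⟨s, hs⟩ := exists_simpleFunc_tendstoUniformly hf hb
  obtain ⟨C, hC⟩ := hb
  choose W hW using fun u =>
    exists_hasIntegral (PL := PL) (mem_squareDomain_of_norm_le hf hC u)
  have hlim (u : H) : Tendsto (fun n => PL.integralSimple (s n) u) atTop (𝓝 (W u)) :=
    HasIntegral.tendsto (fun n => PL.hasIntegral_simpleFunc (s n) u) (hW u)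
      (tendsto_eLpNorm_sub_of_tendstoUniformly hs)
  have : ContinuousConstSMul ℍ[ℝ]ᵐᵒᵖ H := ⟨continuous_qsmul⟩
  let T : H →ₗ[ℍ[ℝ]ᵐᵒᵖ] H :=
    linearMapOfTendsto W (fun n => (PL.integralSimple (s n)).toLinearMap)
      (tendsto_pi_nhds.mpr hlim)
  exact ⟨⟨T, AddMonoidHomClass.continuous_of_bound T C fun u => (hW u).norm_le hC⟩, hW⟩

theorem isBoundedIntegral_integralBounded (hf : Measurable f) (hb : ∃ C, ∀ q, ‖f q‖ ≤ C) :
    PL.IsBoundedIntegral f (PL.integralBounded f) := by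
  have h : ∃ T, PL.IsBoundedIntegral f T :=
    (exists_forall_hasIntegral hf hb).imp fun T => (isBoundedIntegral_iff hf hb).mpr
  rw [integralBounded, dif_pos h]
  exact h.choose_spec

theorem hasIntegral_integralBounded (hf : Measurable f) (hb : ∃ C, ∀ q, ‖f q‖ ≤ C) (u : H) :
    PL.HasIntegral f u (PL.integralBounded f u) :=
  (isBoundedIntegral_iff hf hb).mp (isBoundedIntegral_integralBounded hf hb) u

theorem HasIntegral.tendsto_truncation (hf : Measurable f) (h : PL.HasIntegral f u w) :
    Tendsto (fun n => PL.integralBounded (truncation f n) u) atTop (𝓝 w) := by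
  simp only [truncation_eq_indicator]
  exact HasIntegral.tendsto
    (fun n => hasIntegral_integralBounded (hf.indicator (measurableSet_sublevel hf n))
      ⟨n, norm_indicator_sublevel_le f n⟩ u)
    h (tendsto_eLpNorm_indicator_sub ENNReal.ofNat_ne_top h.1 (measurableSet_sublevel hf)
      (eventually_mem_sublevel f))

theorem mem_graph_integral (hf : Measurable f) :
    (u, w) ∈ (PL.integral f).graph ↔ PL.HasIntegral f u w := by
  rw [integral, Submodule.toLinearPMap_graph_eq]
  · refine ⟨fun ⟨hu, hw⟩ => ?_, fun h => ⟨h.1, h.tendsto_truncation hf⟩⟩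
    obtain ⟨w', hw'⟩ := exists_hasIntegral hu
    obtain rfl := tendsto_nhds_unique hw (hw'.tendsto_truncation hf)
    exact hw'
  · rintro ⟨-, w⟩ ⟨-, hw⟩ rfl
    exact tendsto_nhds_unique hw (by simp only [map_zero, tendsto_const_nhds])

theorem domain_integral (hf : Measurable f) : (PL.integral f).domain = PL.squareDomain f := by
  ext u
  simp only [LinearPMap.mem_domain_iff, mem_graph_integral hf]
  exact ⟨fun ⟨_, h⟩ => h.1, exists_hasIntegral⟩

theorem hasIntegral_integral (hf : Measurable f) (u : (PL.integral f).domain) :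
    PL.HasIntegral f u (PL.integral f u) :=
  (mem_graph_integral hf).mp ((PL.integral f).mem_graph u)

theorem integral_eq_integralBounded (hf : Measurable f) (hb : ∃ C, ∀ q, ‖f q‖ ≤ C) :
    PL.integral f = (PL.integralBounded f).toLinearMap.toPMap ⊤ := by
  refine LinearPMap.eq_of_eq_graph (Submodule.ext fun ⟨u, w⟩ => ?_)
  have hu := hasIntegral_integralBounded (PL := PL) hf hb u
  rw [mem_graph_integral hf, LinearPMap.mem_graph_iff]
  refine ⟨fun h => ⟨⟨u, trivial⟩, rfl, hu.unique h⟩, ?_⟩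
  rintro ⟨u, rfl, rfl⟩
  exact hu

end Complete

/-! ### Products and sums -/

theorem HasIntegral.simpleFunc_mul (h : PL.HasIntegral g u v)
    (s : SimpleFunc (halfPlane ι) ℍ[ℝ]) : PL.HasIntegral (⇑s * g) u (PL.integralSimple s v) := by
  obtain ⟨hgu, t, htg, htv⟩ := h
  obtain ⟨C, hC⟩ := s.exists_forall_norm_le
  have hbound (h : halfPlane ι → ℍ[ℝ]) (q : halfPlane ι) : ‖(⇑s * h) q‖ ≤ C * ‖h q‖ := by
    rw [Pi.mul_apply, norm_mul]
    gcongr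
    exact hC q
  refine ⟨MemLp.of_le_mul hgu (s.aestronglyMeasurable.mul hgu.1) (.of_forall (hbound g)),
    fun n => s * t n, ?_, ?_⟩
  · have hlim : Tendsto (fun n => ENNReal.ofReal C * eLpNorm (⇑(t n) - g) 2 (PL.measure u)) atTop
        (𝓝 0) := by
      simpa using ENNReal.Tendsto.const_mul htg (.inr ENNReal.ofReal_ne_top)
    refine tendsto_of_tendsto_of_tendsto_of_le_of_le tendsto_const_nhds hlim (fun _ => zero_le)
      fun n => ?_
    rw [SimpleFunc.coe_mul, ← mul_sub]
    exact eLpNorm_le_mul_eLpNorm_of_ae_le_mul (.of_forall (hbound _)) 2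
  · simp only [integralSimple_mul]
    exact ((PL.integralSimple s).continuous.tendsto v).comp htv

theorem HasIntegral.P_apply (h : PL.HasIntegral g u v) {E : Set (halfPlane ι)}
    (hE : MeasurableSet E) : PL.HasIntegral (E.indicator g) u (PL.P E v) := by
  have hmul : ⇑((SimpleFunc.const (halfPlane ι) (1 : ℍ[ℝ])).restrict E) * g = E.indicator g := by
    ext1 q
    by_cases hq : q ∈ E <;> simp [hE, hq]
  simpa only [integralSimple_restrict_const_one PL hE, hmul] using
    h.simpleFunc_mul ((SimpleFunc.const _ 1).restrict E)

theorem HasIntegral.measure_eq (h : PL.HasIntegral g u v) :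
    PL.measure v = (PL.measure u).withDensity fun q => ‖g q‖ₑ ^ 2 := by
  refine Measure.ext fun E hE => ?_
  rw [PL.measure_eq_enorm_sq _ hE, (h.P_apply hE).enorm_eq, eLpNorm_two_sq,
    withDensity_apply _ hE, ← lintegral_indicator hE]
  refine lintegral_congr fun q => ?_
  by_cases hq : q ∈ E <;> simp [hq]

theorem HasIntegral.eLpNorm_mul (h : PL.HasIntegral g u v) (hf : Measurable f) (hg : Measurable g) :
    eLpNorm (f * g) 2 (PL.measure u) = eLpNorm f 2 (PL.measure v) := by
  refine (ENNReal.pow_right_strictMono two_ne_zero).injective ?_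
  simp only [eLpNorm_two_sq]
  rw [h.measure_eq, lintegral_withDensity_eq_lintegral_mul _ (hg.enorm.pow_const 2)
    (hf.enorm.pow_const 2)]
  simp only [Pi.mul_apply, enorm_mul, mul_pow, mul_comm]

theorem HasIntegral.mem_squareDomain_iff (h : PL.HasIntegral g u v) (hf : Measurable f)
    (hg : Measurable g) : v ∈ PL.squareDomain f ↔ u ∈ PL.squareDomain (f * g) := by
  rw [mem_squareDomain, mem_squareDomain, MemLp, MemLp, h.eLpNorm_mul hf hg,
    iff_true_intro hf.aestronglyMeasurable, iff_true_intro (hf.mul hg).aestronglyMeasurable]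

section Complete

variable [CompleteSpace H]

theorem HasIntegral.mul (hgu : PL.HasIntegral g u v) (hfv : PL.HasIntegral f v w)
    (hf : Measurable f) (hg : Measurable g) : PL.HasIntegral (f * g) u w := by
  obtain ⟨hv, s, hsf, hsw⟩ := hfv
  refine .of_tendsto (fun n => hgu.simpleFunc_mul (s n)) ((hgu.mem_squareDomain_iff hf hg).mp hv)
    (hsf.congr fun n => ?_) hsw
  rw [← sub_mul, hgu.eLpNorm_mul ((s n).measurable.sub hf) hg]

theorem HasIntegral.mul_iff (hgu : PL.HasIntegral g u v) (hf : Measurable f) (hg : Measurable g) :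
    PL.HasIntegral (f * g) u w ↔ PL.HasIntegral f v w := by
  refine ⟨fun h => ?_, fun h => hgu.mul h hf hg⟩
  obtain ⟨w', hw'⟩ := exists_hasIntegral ((hgu.mem_squareDomain_iff hf hg).mpr h.1)
  rwa [h.unique (hgu.mul hw' hf hg)]

theorem opComp_integral (hf : Measurable f) (hg : Measurable g) :
    opComp (PL.integral f) (PL.integral g) =
      (PL.integral (f * g)).domRestrict (PL.squareDomain g) := by
  refine LinearPMap.eq_of_eq_graph (Submodule.ext fun ⟨u, w⟩ => ?_)
  rw [mem_graph_opComp, mem_graph_domRestrict, mem_graph_integral (hf.mul hg)]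
  simp only [mem_graph_integral hf, mem_graph_integral hg]
  constructor
  · rintro ⟨v, hgu, hfv⟩
    exact ⟨hgu.1, hgu.mul hfv hf hg⟩
  · rintro ⟨hu, h⟩
    obtain ⟨v, hgu⟩ := exists_hasIntegral hu
    exact ⟨v, hgu, (hgu.mul_iff hf hg).mp h⟩

theorem opComp_integral_le (hf : Measurable f) (hg : Measurable g) :
    opComp (PL.integral f) (PL.integral g) ≤ PL.integral (f * g) :=
  (opComp_integral hf hg).trans_le LinearPMap.domRestrict_le

theorem domain_opComp_integral (hf : Measurable f) (hg : Measurable g) :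
    (opComp (PL.integral f) (PL.integral g)).domain =
      PL.squareDomain g ⊓ PL.squareDomain (f * g) := by
  rw [opComp_integral hf hg, LinearPMap.domRestrict_domain, domain_integral (hf.mul hg)]

theorem opComp_integral_eq_iff (hf : Measurable f) (hg : Measurable g) :
    opComp (PL.integral f) (PL.integral g) = PL.integral (f * g) ↔
      PL.squareDomain (f * g) ≤ PL.squareDomain g := by
  rw [opComp_integral hf hg, domRestrict_eq_self_iff, domain_integral (hf.mul hg)]

theorem integral_add_integral (hf : Measurable f) (hg : Measurable g) :
    PL.integral f + PL.integral g =
      (PL.integral (f + g)).domRestrict (PL.squareDomain f ⊓ PL.squareDomain g) := by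
  refine LinearPMap.eq_of_eq_graph (Submodule.ext fun ⟨u, w⟩ => ?_)
  rw [mem_graph_add, mem_graph_domRestrict, mem_graph_integral (hf.add hg)]
  simp only [mem_graph_integral hf, mem_graph_integral hg]
  constructor
  · rintro ⟨v, v', hfu, hgu, rfl⟩
    exact ⟨⟨hfu.1, hgu.1⟩, hfu.add hgu⟩
  · rintro ⟨⟨hfu, hgu⟩, h⟩
    obtain ⟨v, hv⟩ := exists_hasIntegral hfu
    obtain ⟨v', hv'⟩ := exists_hasIntegral hgu
    exact ⟨v, v', hv, hv', (hv.add hv').unique h⟩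

theorem integral_add_integral_le (hf : Measurable f) (hg : Measurable g) :
    PL.integral f + PL.integral g ≤ PL.integral (f + g) :=
  (integral_add_integral hf hg).trans_le LinearPMap.domRestrict_le

theorem domain_integral_add_integral (hf : Measurable f) (hg : Measurable g) :
    (PL.integral f + PL.integral g).domain = PL.squareDomain f ⊓ PL.squareDomain g := by
  rw [LinearPMap.add_domain, domain_integral hf, domain_integral hg]

theorem integral_add_integral_eq_iff (hf : Measurable f) (hg : Measurable g) :
    PL.integral f + PL.integral g = PL.integral (f + g) ↔
      PL.squareDomain (f + g) ≤ PL.squareDomain f ⊓ PL.squareDomain g := by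
  rw [integral_add_integral hf hg, domRestrict_eq_self_iff, domain_integral (hf.add hg)]

end Complete

/-! ### Density of the domain and the adjoint -/

theorem hasIntegral_indicator_one {E : Set (halfPlane ι)} (hE : MeasurableSet E) (u : H) :
    PL.HasIntegral (E.indicator 1) u (PL.P E u) := by
  have hone : ⇑((SimpleFunc.const (halfPlane ι) (1 : ℍ[ℝ])).restrict E) = E.indicator 1 := by
    rw [SimpleFunc.coe_restrict _ hE, SimpleFunc.coe_const]
    rfl
  simpa only [hone, integralSimple_restrict_const_one PL hE] using
    PL.hasIntegral_simpleFunc ((SimpleFunc.const _ 1).restrict E) u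

theorem enorm_P_apply_le {E : Set (halfPlane ι)} (hE : MeasurableSet E) (u : H) :
    ‖PL.P E u‖ₑ ≤ ‖u‖ₑ := by
  refine (ENNReal.pow_right_strictMono two_ne_zero).le_iff_le.mp ?_
  rw [← PL.measure_eq_enorm_sq u hE, ← PL.measure_univ]
  exact measure_mono (Set.subset_univ E)

theorem tendsto_P_apply {E : ℕ → Set (halfPlane ι)} (hE : ∀ n, MeasurableSet (E n))
    (hmem : ∀ q, ∀ᶠ n in atTop, q ∈ E n) (u : H) :
    Tendsto (fun n => PL.P (E n) u) atTop (𝓝 u) := by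
  have hone : PL.HasIntegral 1 u u := by
    simpa only [Set.indicator_univ, PL.P_univ, ContinuousLinearMap.id_apply] using
      hasIntegral_indicator_one (PL := PL) .univ u
  exact HasIntegral.tendsto (fun n => hasIntegral_indicator_one (hE n) u) hone
    (tendsto_eLpNorm_indicator_sub ENNReal.ofNat_ne_top hone.1 hE hmem)

theorem squareDomain_star (f : halfPlane ι → ℍ[ℝ]) :
    PL.squareDomain (star f) = PL.squareDomain f := by
  have hle (g : halfPlane ι → ℍ[ℝ]) : PL.squareDomain g ≤ PL.squareDomain (star g) := fun u hu =>
    MemLp.of_le hu hu.1.star (.of_forall fun q => (norm_star (g q)).le)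
  exact ((hle (star f)).trans_eq (by rw [star_star])).antisymm (hle f)

theorem squareDomain_norm_sq_le (hf : Measurable f) :
    PL.squareDomain (fun q => ((‖f q‖ ^ 2 : ℝ) : ℍ[ℝ])) ≤ PL.squareDomain f := fun u hu => by
  refine MemLp.of_le (hu.norm.add (memLp_const (1 : ℝ))) hf.aestronglyMeasurable
    (.of_forall fun q => ?_)
  have hle : ‖f q‖ ≤ ‖f q‖ ^ 2 + 1 := by nlinarith [sq_nonneg (‖f q‖ - 1)]
  simpa [abs_of_nonneg (by positivity : 0 ≤ ‖f q‖ ^ 2 + 1)] using hle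

theorem HasIntegral.qinner_star_of_bounded (hw : PL.HasIntegral (star f) u w)
    (hz : PL.HasIntegral f v z) (hf : Measurable f) (hb : ∃ C, ∀ q, ‖f q‖ ≤ C) :
    qinner w v = qinner u z := by
  obtain ⟨s, hs⟩ := exists_simpleFunc_tendstoUniformly hf hb
  have hstar : TendstoUniformly (fun n => ⇑((s n).map star)) (star f) atTop :=
    Metric.tendstoUniformly_iff.mpr fun ε hε => by
      simpa only [SimpleFunc.map_apply, Pi.star_apply, dist_star_star] using
        Metric.tendstoUniformly_iff.mp hs ε hε
  have hlimw := HasIntegral.tendsto (fun n => PL.hasIntegral_simpleFunc ((s n).map star) u) hw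
    (tendsto_eLpNorm_sub_of_tendstoUniformly hstar)
  have hlimz := HasIntegral.tendsto (fun n => PL.hasIntegral_simpleFunc (s n) v) hz
    (tendsto_eLpNorm_sub_of_tendstoUniformly hs)
  have hmap (n : ℕ) : ((s n).map star).map star = s n := by
    ext1 q
    simp only [SimpleFunc.map_apply, star_star]
  refine tendsto_nhds_unique (((continuous_qinner_left v).tendsto w).comp hlimw)
    ((((continuous_qinner_right u).tendsto z).comp hlimz).congr fun n => ?_)
  simp only [Function.comp_apply]
  rw [qinner_integralSimple_left, hmap]

theorem HasIntegral.qinner_star (hw : PL.HasIntegral (star f) u w) (hz : PL.HasIntegral f v z)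
    (hf : Measurable f) : qinner w v = qinner u z := by
  have hE := measurableSet_sublevel hf
  have hbdd (n : ℕ) : qinner (PL.P (sublevel f n) w) v = qinner u (PL.P (sublevel f n) z) :=
    HasIntegral.qinner_star_of_bounded (indicator_star _ f ▸ hw.P_apply (hE n))
      (hz.P_apply (hE n)) (hf.indicator (hE n)) ⟨n, norm_indicator_sublevel_le f n⟩
  have hlim := tendsto_P_apply (PL := PL) hE (eventually_mem_sublevel f)
  exact tendsto_nhds_unique (((continuous_qinner_left v).tendsto w).comp (hlim w))
    ((((continuous_qinner_right u).tendsto z).comp (hlim z)).congr fun n => (hbdd n).symm)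

section Complete

variable [CompleteSpace H]

theorem hasIntegral_P_apply_iff (hf : Measurable f) {E : Set (halfPlane ι)}
    (hE : MeasurableSet E) :
    PL.HasIntegral f (PL.P E u) w ↔ PL.HasIntegral (E.indicator f) u w := by
  have hmul : f * E.indicator 1 = E.indicator f := by
    ext1 q
    by_cases hq : q ∈ E <;> simp [hq]
  rw [← hmul]
  exact ((hasIntegral_indicator_one hE u).mul_iff hf (measurable_one.indicator hE)).symm

theorem exists_hasIntegral_indicator_sublevel (hf : Measurable f) (n : ℕ) (u : H) :
    ∃ w, PL.HasIntegral ((sublevel f n).indicator f) u w :=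
  exists_hasIntegral (mem_squareDomain_of_norm_le (hf.indicator (measurableSet_sublevel hf n))
    (norm_indicator_sublevel_le f n) u)

theorem dense_squareDomain (hf : Measurable f) : Dense (PL.squareDomain f : Set H) := fun u => by
  have hE := measurableSet_sublevel hf
  refine mem_closure_of_tendsto (tendsto_P_apply (PL := PL) hE (eventually_mem_sublevel f) u)
    (.of_forall fun n => ?_)
  obtain ⟨w, hw⟩ := exists_hasIntegral_indicator_sublevel (PL := PL) hf n u
  exact ((hasIntegral_P_apply_iff hf (hE n)).mpr hw).1

theorem hasIntegral_indicator_star_of_mem_adjointGraph (hf : Measurable f)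
    (h : (u, w) ∈ adjointGraph (PL.integral f)) (n : ℕ) :
    PL.HasIntegral ((sublevel f n).indicator (star f)) u (PL.P (sublevel f n) w) := by
  have hE := measurableSet_sublevel hf n
  obtain ⟨x, hx⟩ : ∃ x, PL.HasIntegral ((sublevel f n).indicator (star f)) u x := by
    obtain ⟨z, hz⟩ := exists_hasIntegral_indicator_sublevel (PL := PL) hf n u
    exact exists_hasIntegral (by rw [indicator_star, squareDomain_star]; exact hz.1)
  suffices hxw : x = PL.P (sublevel f n) w from hxw ▸ hx
  refine ext_qinner_left fun v => ?_
  obtain ⟨z, hz⟩ := exists_hasIntegral_indicator_sublevel (PL := PL) hf n v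
  obtain ⟨y, hy, hyz⟩ := (PL.integral f).mem_graph_iff.mp
    ((mem_graph_integral hf).mpr ((hasIntegral_P_apply_iff hf hE).mpr hz))
  dsimp only at hy hyz
  calc qinner x v = qinner u z :=
        HasIntegral.qinner_star (indicator_star _ f ▸ hx) hz (hf.indicator hE)
    _ = qinner w (PL.P (sublevel f n) v) := by rw [← hyz, ← hy]; exact (h y).symm
    _ = qinner (PL.P (sublevel f n) w) v := (PL.qinner_P_left hE w v).symm

theorem mem_adjointGraph_integral (hf : Measurable f) :
    (u, w) ∈ adjointGraph (PL.integral f) ↔ PL.HasIntegral (star f) u w := by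
  refine ⟨fun h => ?_, fun h v => h.qinner_star (hasIntegral_integral hf v) hf⟩
  have hE := measurableSet_sublevel hf
  have hmem := eventually_mem_sublevel f
  have hint := hasIntegral_indicator_star_of_mem_adjointGraph hf h
  have hu : u ∈ PL.squareDomain (star f) := by
    have hfs : AEStronglyMeasurable (star f) (PL.measure u) :=
      (measurable_star hf).aestronglyMeasurable
    refine ⟨hfs, (eLpNorm_le_of_eLpNorm_indicator_le hfs hE hmem fun n => ?_).trans_lt
      (enorm_lt_top (x := w))⟩
    rw [← (hint n).enorm_eq]
    exact enorm_P_apply_le (hE n) w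
  exact .of_tendsto hint hu (tendsto_eLpNorm_indicator_sub ENNReal.ofNat_ne_top hu hE hmem)
    (tendsto_P_apply hE hmem w)

theorem adjointGraph_integral (hf : Measurable f) :
    adjointGraph (PL.integral f) = (PL.integral (star f)).graph :=
  Submodule.ext fun ⟨_, _⟩ => (mem_adjointGraph_integral hf).trans
    (mem_graph_integral (measurable_star hf)).symm

theorem opAdjoint_integral (hf : Measurable f) :
    opAdjoint (PL.integral f) = PL.integral (star f) := by
  refine LinearPMap.eq_of_eq_graph ?_
  rw [opAdjoint, adjointGraph_integral hf, Submodule.toLinearPMap_graph_eq]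
  exact fun _ hx hx₀ => LinearPMap.graph_fst_eq_zero_snd _ hx hx₀

theorem opIsClosed_integral (hf : Measurable f) : OpIsClosed (PL.integral f) := by
  have h := isClosed_adjointGraph (PL.integral (star f))
  rwa [adjointGraph_integral (measurable_star hf), star_star] at h

theorem opComp_opAdjoint_integral (hf : Measurable f) :
    opComp (opAdjoint (PL.integral f)) (PL.integral f) =
      PL.integral (fun q => ((‖f q‖ ^ 2 : ℝ) : ℍ[ℝ])) := by
  have hmul : star f * f = fun q => ((‖f q‖ ^ 2 : ℝ) : ℍ[ℝ]) := funext fun q => by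
    rw [Pi.mul_apply, Pi.star_apply, Quaternion.star_mul_self, Quaternion.normSq_eq_norm_mul_self,
      pow_two]
  rw [opAdjoint_integral hf, ← hmul]
  refine (opComp_integral_eq_iff (measurable_star hf) hf).mpr ?_
  rw [hmul]
  exact squareDomain_norm_sq_le hf

theorem opComp_integral_opAdjoint (hf : Measurable f) :
    opComp (PL.integral f) (opAdjoint (PL.integral f)) =
      PL.integral (fun q => ((‖f q‖ ^ 2 : ℝ) : ℍ[ℝ])) := by
  have h := opComp_opAdjoint_integral (PL := PL) (measurable_star hf)
  simpa only [opAdjoint_integral (measurable_star hf), opAdjoint_integral hf, star_star,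
    Pi.star_apply, norm_star] using h

theorem opIsNormal_integral (hf : Measurable f) : OpIsNormal (PL.integral f) :=
  (opComp_integral_opAdjoint hf).trans (opComp_opAdjoint_integral hf).symm

end Complete

/-! ### Essential boundedness -/

theorem isEssBounded_iff : PL.IsEssBounded f ↔ ∃ k : ℝ≥0, PL.P {q | (k : ℝ) < ‖f q‖} = 0 := by
  simp only [IsEssBounded, essNorm, iInf_lt_iff, ENNReal.coe_lt_top, exists_prop, and_true]

theorem IsEssBounded.squareDomain_eq_top (hf : Measurable f) (h : PL.IsEssBounded f) :
    PL.squareDomain f = ⊤ := by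
  obtain ⟨k, hk⟩ := isEssBounded_iff.mp h
  refine eq_top_iff.mpr fun u _ => MemLp.of_bound hf.aestronglyMeasurable k ?_
  rw [ae_iff]
  simp only [not_le]
  rw [PL.measure_eq_enorm_sq u (measurableSet_lt measurable_const hf.norm), hk]
  simp

section Complete

variable [CompleteSpace H]

theorem mul_norm_P_apply_le (hf : Measurable f) {k : ℝ} (hk : 0 ≤ k)
    (h : PL.HasIntegral f (PL.P {q | k < ‖f q‖} u) w) : k * ‖PL.P {q | k < ‖f q‖} u‖ ≤ ‖w‖ := by
  have hE : MeasurableSet {q | k < ‖f q‖} := measurableSet_lt measurable_const hf.norm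
  have hle : ‖k * ‖PL.P {q | k < ‖f q‖} u‖‖ₑ ≤ ‖w‖ₑ := by
    rw [enorm_mul, enorm_norm, (hasIntegral_indicator_one hE u).enorm_eq,
      ((hasIntegral_P_apply_iff hf hE).mp h).enorm_eq, ← eLpNorm_const_smul]
    refine eLpNorm_mono fun q => ?_
    by_cases hq : k < ‖f q‖
    · simpa [hq, norm_smul, abs_of_nonneg hk] using hq.le
    · simp [hq]
  exact (Real.le_norm_self _).trans (enorm_le_iff_norm_le.mp hle)

theorem isEssBounded_of_squareDomain_eq_top (hf : Measurable f) (h : PL.squareDomain f = ⊤) :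
    PL.IsEssBounded f := by
  obtain ⟨M, hM⟩ :=
    (opIsClosed_integral (PL := PL) hf).exists_norm_le ((domain_integral hf).trans h)
  have hk : 0 ≤ |M| + 1 := by positivity
  refine isEssBounded_iff.mpr ⟨⟨|M| + 1, hk⟩, ContinuousLinearMap.ext fun u => ?_⟩
  let v := PL.P {q | |M| + 1 < ‖f q‖} u
  obtain ⟨w, hw⟩ : ∃ w, PL.HasIntegral f v w := exists_hasIntegral (h ▸ trivial)
  have hle : (|M| + 1) * ‖v‖ ≤ |M| * ‖v‖ :=
    calc (|M| + 1) * ‖v‖ ≤ ‖w‖ := mul_norm_P_apply_le hf hk hw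
      _ ≤ M * ‖v‖ := hM v w ((mem_graph_integral hf).mpr hw)
      _ ≤ |M| * ‖v‖ := by gcongr; exact le_abs_self M
  have hv₀ : ‖v‖ ≤ 0 := by linarith
  exact norm_le_zero_iff.mp hv₀

theorem squareDomain_eq_top_iff (hf : Measurable f) :
    PL.squareDomain f = ⊤ ↔ PL.IsEssBounded f :=
  ⟨isEssBounded_of_squareDomain_eq_top hf, fun h => h.squareDomain_eq_top hf⟩

theorem opComp_integral_of_isEssBounded (hf : Measurable f) (hg : Measurable g)
    (h : PL.IsEssBounded g) : opComp (PL.integral f) (PL.integral g) = PL.integral (f * g) :=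
  (opComp_integral_eq_iff hf hg).mpr ((h.squareDomain_eq_top hg).symm ▸ le_top)

theorem integral_add_integral_of_isEssBounded (hf : Measurable f) (hg : Measurable g)
    (h : PL.IsEssBounded f ∨ PL.IsEssBounded g) :
    PL.integral f + PL.integral g = PL.integral (f + g) := by
  refine (integral_add_integral_eq_iff hf hg).mpr fun u hu => ?_
  rcases h with h | h
  · have hfu : u ∈ PL.squareDomain f := h.squareDomain_eq_top hf ▸ trivial
    exact ⟨hfu, add_sub_cancel_left f g ▸ MemLp.sub hu hfu⟩
  · have hgu : u ∈ PL.squareDomain g := h.squareDomain_eq_top hg ▸ trivial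
    exact ⟨add_sub_cancel_right f g ▸ MemLp.sub hu hgu, hgu⟩

end Complete

/-! ### Change of variables -/

variable {κ : ℍ[ℝ]} {Ψ : halfPlane ι → halfPlane κ} {ξ : halfPlane κ → ℍ[ℝ]}

/-- The image of an iqPVM under a Borel map of half planes. -/
def map (PL : IqPVM ι H) (hΨ : Measurable Ψ) : IqPVM κ H where
  P E := PL.P (Ψ ⁻¹' E)
  L := PL.L
  P_univ := PL.P_univ
  P_inter _ _ hE hF := PL.P_inter _ _ (hΨ hE) (hΨ hF)
  P_iUnion E hE hd u := by
    rw [Set.preimage_iUnion]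
    exact PL.P_iUnion _ (fun n => hΨ (hE n)) (fun i j hij => (hd hij).preimage Ψ) u
  P_nonneg _ hE := PL.P_nonneg _ (hΨ hE)
  isLeftScalarMul := PL.isLeftScalarMul
  P_comm _ hE := PL.P_comm _ (hΨ hE)

theorem measure_map (hΨ : Measurable Ψ) (u : H) :
    (PL.map hΨ).measure u = (PL.measure u).map Ψ := by
  refine Measure.ext fun E hE => ?_
  rw [Measure.map_apply hΨ hE, measure_apply _ _ hE, measure_apply _ _ (hΨ hE)]
  rfl

theorem integralSimple_map_eq_comp (hΨ : Measurable Ψ) (s : SimpleFunc (halfPlane κ) ℍ[ℝ]) (u : H) :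
    (PL.map hΨ).integralSimple s u = PL.integralSimple (s.comp Ψ hΨ) u :=
  ((PL.map hΨ).integralSimple_apply s u).trans
    (PL.integralSimple_apply_of_subset (s.comp Ψ hΨ) (s.range_comp_subset_range hΨ) u).symm

theorem squareDomain_map (hΨ : Measurable Ψ) (hξ : Measurable ξ) :
    (PL.map hΨ).squareDomain ξ = PL.squareDomain (ξ ∘ Ψ) := by
  ext u
  rw [mem_squareDomain, mem_squareDomain, measure_map hΨ,
    memLp_map_measure_iff hξ.aestronglyMeasurable hΨ.aemeasurable]

theorem HasIntegral.comp {hΨ : Measurable Ψ} (h : (PL.map hΨ).HasIntegral ξ u w)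
    (hξ : Measurable ξ) : PL.HasIntegral (ξ ∘ Ψ) u w := by
  obtain ⟨hu, s, hsξ, hsw⟩ := h
  refine ⟨(squareDomain_map (PL := PL) hΨ hξ).le hu, fun n => (s n).comp Ψ hΨ,
    hsξ.congr fun n => ?_, ?_⟩
  · have hsub : Measurable (⇑(s n) - ξ) := (s n).measurable.sub hξ
    rw [measure_map hΨ, eLpNorm_map_measure hsub.aestronglyMeasurable hΨ.aemeasurable]
    rfl
  · simpa only [integralSimple_map_eq_comp] using hsw

theorem integral_comp [CompleteSpace H] (hΨ : Measurable Ψ) (hξ : Measurable ξ) :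
    PL.integral (ξ ∘ Ψ) = (PL.map hΨ).integral ξ := by
  have hξΨ := hξ.comp hΨ
  have hle : (PL.map hΨ).integral ξ ≤ PL.integral (ξ ∘ Ψ) :=
    LinearPMap.le_of_le_graph fun ⟨_, _⟩ h =>
      (mem_graph_integral hξΨ).mpr (((mem_graph_integral hξ).mp h).comp hξ)
  refine (LinearPMap.eq_of_le_of_domain_eq hle ?_).symm
  rw [domain_integral hξ, domain_integral hξΨ, squareDomain_map hΨ hξ]

end IqPVM

end QuaternionicIntegral

theorem mainTheorem12 {H : Type*} [NormedAddCommGroup H] [Module ℍ[ℝ]ᵐᵒᵖ H]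
    [QInnerProductSpace H] [CompleteSpace H]
    (ι : ℍ[ℝ]) (_hι : ι ∈ imaginaryUnits) (PL : IqPVM ι H)
    (f g : halfPlane ι → ℍ[ℝ]) (_hf : Measurable f) (_hg : Measurable g) :
    -- the operator `∫ f dPL` is well defined on the dense subspace `D_f`
    ((PL.integral f).domain = PL.squareDomain f ∧
      Dense (PL.squareDomain f : Set H) ∧
      (∀ u : (PL.integral f).domain,
        Tendsto (fun n : ℕ => PL.integralBounded (IqPVM.truncation f n) (u : H)) atTop
          (𝓝 (PL.integral f u))) ∧
      ((∃ C : ℝ, ∀ q, ‖f q‖ ≤ C) →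
        PL.IsBoundedIntegral f (PL.integralBounded f) ∧
        PL.integral f = (PL.integralBounded f).toLinearMap.toPMap ⊤)) ∧
    -- (a) products
    ((opComp (PL.integral f) (PL.integral g)).domain =
        PL.squareDomain g ⊓ PL.squareDomain (fun q => f q * g q) ∧
      opComp (PL.integral f) (PL.integral g) ≤ PL.integral (fun q => f q * g q) ∧
      (opComp (PL.integral f) (PL.integral g) = PL.integral (fun q => f q * g q) ↔
        PL.squareDomain (fun q => f q * g q) ≤ PL.squareDomain g)) ∧
    -- (b) sums
    ((PL.integral f + PL.integral g).domain = PL.squareDomain f ⊓ PL.squareDomain g ∧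
      PL.integral f + PL.integral g ≤ PL.integral (fun q => f q + g q) ∧
      (PL.integral f + PL.integral g = PL.integral (fun q => f q + g q) ↔
        PL.squareDomain (fun q => f q + g q) ≤ PL.squareDomain f ⊓ PL.squareDomain g)) ∧
    -- (c) adjoint and closedness
    (PL.squareDomain f = PL.squareDomain (fun q => star (f q)) ∧
      opAdjoint (PL.integral f) = PL.integral (fun q => star (f q)) ∧
      OpIsClosed (PL.integral f)) ∧
    -- (d) normality
    (OpIsNormal (PL.integral f) ∧
      opComp (opAdjoint (PL.integral f)) (PL.integral f) =
        PL.integral (fun q => ((‖f q‖ ^ 2 : ℝ) : ℍ[ℝ])) ∧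
      opComp (PL.integral f) (opAdjoint (PL.integral f)) =
        PL.integral (fun q => ((‖f q‖ ^ 2 : ℝ) : ℍ[ℝ]))) ∧
    -- (e) essential boundedness
    ((PL.squareDomain f = ⊤ ↔ PL.IsEssBounded f) ∧
      (PL.IsEssBounded g →
        opComp (PL.integral f) (PL.integral g) = PL.integral (fun q => f q * g q)) ∧
      (PL.IsEssBounded f ∨ PL.IsEssBounded g →
        PL.integral f + PL.integral g = PL.integral (fun q => f q + g q))) ∧
    -- (f) change of variables
    (∀ κ ∈ imaginaryUnits, ∀ Ψ : halfPlane ι → halfPlane κ, Measurable Ψ →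
      ∃ QL : IqPVM κ H, (QL.P = fun E => PL.P (Ψ ⁻¹' E)) ∧ QL.L = PL.L ∧
        ∀ ξ : halfPlane κ → ℍ[ℝ], Measurable ξ → PL.integral (ξ ∘ Ψ) = QL.integral ξ) := by
  open QuaternionicIntegral.IqPVM in
  refine ⟨⟨domain_integral _hf, dense_squareDomain _hf,
      fun u => (hasIntegral_integral _hf u).tendsto_truncation _hf,
      fun hb => ⟨isBoundedIntegral_integralBounded _hf hb, integral_eq_integralBounded _hf hb⟩⟩,
    ⟨domain_opComp_integral _hf _hg, opComp_integral_le _hf _hg, opComp_integral_eq_iff _hf _hg⟩,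
    ⟨domain_integral_add_integral _hf _hg, integral_add_integral_le _hf _hg,
      integral_add_integral_eq_iff _hf _hg⟩,
    ⟨(squareDomain_star f).symm, opAdjoint_integral _hf, opIsClosed_integral _hf⟩,
    ⟨opIsNormal_integral _hf, opComp_opAdjoint_integral _hf, opComp_integral_opAdjoint _hf⟩,
    ⟨squareDomain_eq_top_iff _hf, opComp_integral_of_isEssBounded _hf _hg,
      integral_add_integral_of_isEssBounded _hf _hg⟩,
    fun _ _ _ hΨ => ⟨PL.map hΨ, rfl, rfl, fun _ hξ => integral_comp hΨ hξ⟩⟩
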